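/- Let $B_6 = O(6,\mathbb{Z})$ be the hyperoctahedral group, i.e. the group of signed $6\times 6$ permutation matrices, and let $B_6^+ = \{A \in B_6 : \det A = 1\}$. Let $\mathcal{I}\cong A_5$ be the icosahedral group and let $T_1, T_2$ be its two inequivalent three-dimensional irreducible real representations, with characters $\chi_{T_1},\chi_{T_2}$. Call a subgroup $\mathcal{H}$ of $B_6$ a crystallographic representation of $\mathcal{I}$ if there is an isomorphism $e:\mathcal{I}\to\mathcal{H}$ such that $\operatorname{tr} e(g) = \chi_{T_1}(g)+\chi_{T_2}(g)$ for all $g\in\mathcal{I}$. For a subgroup $H$ of a group $G$, its conjugacy class in $G$ is $\mathcal{C}_G(H)=\{gHg^{-1} : g\in G\}$. Then: 1. The set of crystallographic representations of $\mathcal{I}$ in $B_6$ is exactly one conjugacy class of subgroups of $B_6$, and this class has exactly $192$ members. 2. Every crystallographic representation of $\mathcal{I}$ in $B_6$ is contained in $B_6^+$, and, as subgroups of $B_6^+$, the crystallographic representations form the union of exactly two distinct conjugacy classes of $B_6^+$, each with exactly $96$ members. -/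

import Mathlib

/-- The hyperoctahedral group `B₆ = O(6, ℤ)`: integral `6 × 6` matrices `A` with `A Aᵀ = 1`,
i.e. the signed permutation matrices. -/
abbrev B6 : Type := Matrix.orthogonalGroup (Fin 6) ℤ

/-- The icosahedral group, as the alternating group `A₅`. -/
abbrev Icosahedral : Type := alternatingGroup (Fin 5)

/-- The subgroup `B₆⁺` of the matrices of determinant `1`. -/
def B6Plus : Subgroup B6 where
  carrier := {A | (A : Matrix (Fin 6) (Fin 6) ℤ).det = 1}
  one_mem' := by simp
  mul_mem' := by
    intro A B hA hB
    simp only [Set.mem_ofPred_eq] at hA hB ⊢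
    rw [Submonoid.coe_mul, Matrix.det_mul, hA, hB, one_mul]
  inv_mem' := by
    intro A hA
    simp only [Set.mem_ofPred_eq] at hA ⊢
    have h : ((A : Matrix (Fin 6) (Fin 6) ℤ) *
        ((A⁻¹ : B6) : Matrix (Fin 6) (Fin 6) ℤ)).det = 1 := by
      rw [← Submonoid.coe_mul, mul_inv_cancel, Submonoid.coe_one, Matrix.det_one]
    rwa [Matrix.det_mul, hA, one_mul] at h

/-- The conjugacy class `{g H g⁻¹ : g ∈ G}` of the subgroup `H` in `G`. -/
def subgroupConjClass {G : Type*} [Group G] (H : Subgroup G) : Set (Subgroup G) :=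
  {K | ∃ g : G, K = H.map (MulAut.conj g).toMonoidHom}

/-- A subgroup `H` of `B₆` is a crystallographic representation of the icosahedral group: it is
isomorphic to that group and, along an isomorphism, its character (the trace of its matrices) is
`χ_{T₁} + χ_{T₂}`, where `T₁`, `T₂` are the two inequivalent three-dimensional irreducible real
representations of the icosahedral group. -/
def IsCrystallographicRep (H : Subgroup B6) : Prop :=
  ∃ (e : Icosahedral ≃* H) (T₁ T₂ : Representation ℝ Icosahedral (Fin 3 → ℝ)),
    T₁.IsIrreducible ∧ T₂.IsIrreducible ∧ IsEmpty (T₁.Equiv T₂) ∧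
    ∀ g : Icosahedral,
      ((((e g : H) : B6) : Matrix (Fin 6) (Fin 6) ℤ).trace : ℝ) = T₁.character g + T₂.character g

/-! The model is the conjugation action of `A₅` on the twelve 5-cycles in the class of `baseCycle`.
They form six pairs `{c, c⁻¹}`, the axes of the icosahedron, and reading `c⁻¹` as `-c` gives the
monomial representation `axisRep`, induced from the sign character of the dihedral stabilizer of one
axis.

Uniqueness (`exists_conj_axisRep`): of the trace condition only the vanishing of the character sum
is needed, which holds because a three-dimensional irreducible representation has no invariants. It
forces `∑ ρ g = 0`, hence every diagonal entry sums to zero. An element of order 5 fixes some basis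
vector. The zero sum makes some group element negate that vector, and orders of elements in `A₅`
then identify its stabilizer and sign with those of the model, so `ρ` is conjugate to `axisRep`.

Existence (`isCrystallographicRep_range_axisRep`): for each root `φ` of `x² = x + 1` the six axes in
`ℝ³` have a Gram matrix commuting with `axisRep`. Compressing to its three-dimensional image gives
an irreducible representation, and the compressions for the two roots have characters adding up to
that of `axisRep`.

Counting: the normalizer of the model has order `240 = 60 · 4` (`card_normalizes`), an outer
automorphism of `A₅` and `-1` being realised by powers of `outerElement`. Since `B₆` has order
46080, there are 192 conjugates. The whole normalizer has determinant 1, so the class splits in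
`B₆⁺` into two halves exchanged by an element of determinant `-1`. -/

/-! ### Signed permutation matrices -/

/-- The matrix sending the `j`-th standard basis vector to `s j` times the `σ j`-th one. -/
def signedPermMatrix (σ : Equiv.Perm (Fin 6)) (s : Fin 6 → ℤˣ) : Matrix (Fin 6) (Fin 6) ℤ :=
  Matrix.of fun i j => if i = σ j then (s j : ℤ) else 0

theorem signedPermMatrix_apply (σ : Equiv.Perm (Fin 6)) (s : Fin 6 → ℤˣ) (i j : Fin 6) :
    signedPermMatrix σ s i j = if i = σ j then (s j : ℤ) else 0 := rfl

theorem signedPermMatrix_mul (σ τ : Equiv.Perm (Fin 6)) (s t : Fin 6 → ℤˣ) :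
    signedPermMatrix σ s * signedPermMatrix τ t =
      signedPermMatrix (σ * τ) (fun j => s (τ j) * t j) := by
  ext i j
  rw [Matrix.mul_apply, Finset.sum_eq_single (τ j)]
  · simp only [signedPermMatrix_apply, Equiv.Perm.mul_apply, if_pos, Units.val_mul, ite_mul,
      zero_mul]
    rfl
  · intro k _ hk
    rw [signedPermMatrix_apply τ, if_neg hk, mul_zero]
  · exact fun h => absurd (Finset.mem_univ _) h

theorem signedPermMatrix_one : signedPermMatrix 1 1 = 1 := by
  ext i j
  rw [signedPermMatrix_apply, Matrix.one_apply]
  rfl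

theorem signedPermMatrix_injective {σ τ : Equiv.Perm (Fin 6)} {s t : Fin 6 → ℤˣ}
    (h : signedPermMatrix σ s = signedPermMatrix τ t) : σ = τ ∧ s = t := by
  have key : ∀ j, σ j = τ j ∧ s j = t j := by
    intro j
    have h1 := congrFun (congrFun h (σ j)) j
    rw [signedPermMatrix_apply, signedPermMatrix_apply, if_pos rfl] at h1
    by_cases h2 : σ j = τ j
    · rw [if_pos h2] at h1
      exact ⟨h2, Units.ext h1⟩
    · rw [if_neg h2] at h1
      exact absurd h1 (Units.ne_zero _)
  exact ⟨Equiv.ext fun j => (key j).1, funext fun j => (key j).2⟩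

theorem signedPermMatrix_mem (σ : Equiv.Perm (Fin 6)) (s : Fin 6 → ℤˣ) :
    signedPermMatrix σ s ∈ Matrix.orthogonalGroup (Fin 6) ℤ := by
  rw [Matrix.mem_orthogonalGroup_iff']
  ext i j
  change ∑ k, signedPermMatrix σ s k i * signedPermMatrix σ s k j = _
  rw [Finset.sum_eq_single (σ i), Matrix.one_apply, signedPermMatrix_apply, signedPermMatrix_apply,
    if_pos rfl]
  · simp only [EmbeddingLike.apply_eq_iff_eq]
    split_ifs with h
    · rw [← h, ← Units.val_mul, Int.units_mul_self, Units.val_one]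
    · rw [mul_zero]
  · intro k _ hk
    rw [signedPermMatrix_apply, if_neg hk, zero_mul]
  · exact fun h => absurd (Finset.mem_univ _) h

theorem B6.transpose_mul_self (A : B6) : A.1.transpose * A.1 = 1 :=
  (Matrix.mem_orthogonalGroup_iff' (Fin 6) ℤ).1 A.2

theorem B6.coe_inv (A : B6) : (A⁻¹ : B6).1 = A.1.transpose := rfl

/-- Every column of an integral orthogonal matrix is a standard basis vector up to sign. -/
theorem B6.exists_col_eq (A : B6) (j : Fin 6) :
    ∃ (i : Fin 6) (u : ℤˣ), ∀ k, A.1 k j = if k = i then (u : ℤ) else 0 := by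
  have h1 : ∑ k, A.1 k j * A.1 k j = 1 := by
    have h := congrFun (congrFun A.transpose_mul_self j) j
    simpa [Matrix.mul_apply] using h
  obtain ⟨i, hi⟩ : ∃ i, A.1 i j ≠ 0 := by
    by_contra! h
    simp [h] at h1
  have h2 := Finset.add_sum_erase Finset.univ (fun k => A.1 k j * A.1 k j) (Finset.mem_univ i)
  have h3 : 0 ≤ ∑ k ∈ Finset.univ.erase i, A.1 k j * A.1 k j :=
    Finset.sum_nonneg fun k _ => mul_self_nonneg _
  have h4 : 0 < A.1 i j * A.1 i j := mul_self_pos.2 hi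
  have h5 : A.1 i j * A.1 i j = 1 := by simp only [h1] at h2; omega
  have h6 : ∑ k ∈ Finset.univ.erase i, A.1 k j * A.1 k j = 0 := by simp only [h1] at h2; omega
  rw [Finset.sum_eq_zero_iff_of_nonneg fun k _ => mul_self_nonneg _] at h6
  refine ⟨i, ⟨A.1 i j, A.1 i j, h5, h5⟩, fun k => ?_⟩
  by_cases hk : k = i
  · rw [if_pos hk, hk]
  · rw [if_neg hk]
    exact mul_self_eq_zero.1 (h6 k (Finset.mem_erase.2 ⟨hk, Finset.mem_univ k⟩))

theorem B6.exists_eq_signedPermMatrix (A : B6) : ∃ σ s, A.1 = signedPermMatrix σ s := by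
  choose f s hf using A.exists_col_eq
  have hinj : Function.Injective f := by
    intro j k hjk
    by_contra hne
    have h := congrFun (congrFun A.transpose_mul_self j) k
    rw [Matrix.mul_apply, Matrix.one_apply_ne hne] at h
    simp [hf, hjk] at h
  refine ⟨Equiv.ofBijective f (Finite.injective_iff_bijective.1 hinj), s, ?_⟩
  ext i j
  rw [hf, signedPermMatrix_apply, Equiv.ofBijective_apply]

theorem card_B6 : Nat.card B6 = 46080 := by
  let F : Equiv.Perm (Fin 6) × (Fin 6 → ℤˣ) → B6 := fun x =>
    ⟨signedPermMatrix x.1 x.2, signedPermMatrix_mem x.1 x.2⟩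
  have hF : Function.Bijective F := by
    constructor
    · intro x y h
      have := signedPermMatrix_injective (congrArg Subtype.val h)
      exact Prod.ext this.1 this.2
    · intro A
      obtain ⟨σ, s, h⟩ := A.exists_eq_signedPermMatrix
      exact ⟨(σ, s), Subtype.ext h.symm⟩
  rw [← Nat.card_eq_of_bijective F hF, Nat.card_prod, Nat.card_eq_fintype_card,
    Nat.card_eq_fintype_card, Fintype.card_perm, Fintype.card_fun]
  simp [Nat.factorial, Fintype.card_units_int]

instance : Finite B6 := Nat.finite_of_card_ne_zero (by rw [card_B6]; norm_num)

/-- If the `j`-th column of `B` is a multiple of the `i`-th basis vector, then the `j`-th column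
of `A * B` is that multiple of the `i`-th column of `A`. -/
theorem B6.mul_apply_of_col {A B : B6} {i j : Fin 6} {u : ℤ}
    (h : ∀ k, B.1 k j = if k = i then u else 0) (l : Fin 6) :
    (A * B).1 l j = A.1 l i * u := by
  rw [Submonoid.coe_mul, Matrix.mul_apply]
  simp [h]

/-- A signed permutation matrix of order dividing `5` fixes a standard basis vector. -/
theorem B6.exists_apply_self_eq_one_of_pow_five {A : B6} (hA : A ^ 5 = 1) :
    ∃ i, A.1 i i = 1 := by
  obtain ⟨σ, s, h⟩ := A.exists_eq_signedPermMatrix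
  have hpow : ∀ n : ℕ, ∃ t, (A ^ n).1 = signedPermMatrix (σ ^ n) t := by
    intro n
    induction n with
    | zero => exact ⟨1, by rw [pow_zero, pow_zero, signedPermMatrix_one]; rfl⟩
    | succ n ih =>
      obtain ⟨t, ht⟩ := ih
      exact ⟨_, by rw [pow_succ, Submonoid.coe_mul, ht, h, signedPermMatrix_mul, ← pow_succ]⟩
  have hσ : σ ^ 5 = 1 := by
    obtain ⟨t, ht⟩ := hpow 5
    rw [hA, Submonoid.coe_one, ← signedPermMatrix_one] at ht
    exact (signedPermMatrix_injective ht).1.symm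
  have : Fact (Nat.Prime 5) := ⟨by norm_num⟩
  -- A permutation of order dividing 5 has a fixed point because 5 does not divide 6; the sign there
  -- is `1` because its fifth power is.
  obtain ⟨i, hi⟩ := Equiv.Perm.exists_fixed_point_of_prime (p := 5) (n := 1) (σ := σ)
    (by simp) (by simpa using hσ)
  refine ⟨i, ?_⟩
  have hs : A.1 i i = s i := by rw [h, signedPermMatrix_apply, hi, if_pos rfl]
  have hcol : ∀ k, A.1 k i = if k = i then (s i : ℤ) else 0 := fun k => by
    rw [h, signedPermMatrix_apply, hi]
  have hp : ∀ n : ℕ, (A ^ n).1 i i = (s i : ℤ) ^ n := by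
    intro n
    induction n with
    | zero => simp
    | succ n ih => rw [pow_succ, B6.mul_apply_of_col hcol, ih, pow_succ]
  have h5 := hp 5
  rw [hA] at h5
  rw [hs]
  rcases Int.units_eq_one_or (s i) with h1 | h1
  · rw [h1]; rfl
  · rw [h1] at h5
    simp at h5

/-! ### The alternating group on five letters and its `5`-cycles -/

/-- The `5`-cycle `(0 1 2 3 4)`. -/
def baseCycle : Equiv.Perm (Fin 5) where
  toFun := ![1, 2, 3, 4, 0]
  invFun := ![4, 0, 1, 2, 3]
  left_inv := by decide
  right_inv := by decide

/-- Even permutations conjugating `baseCycle` to representatives of the six pairs `{c, c⁻¹}` in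
its conjugacy class in `A₅`. -/
def axisTransversal : Fin 6 → Equiv.Perm (Fin 5) :=
  -- With this choice conjugation by `baseCycle` fixes axis 0 and permutes axes 1 to 5 cyclically,
  -- with no signs.
  let x := Equiv.swap 2 3 * Equiv.swap 3 4
  ![1, x, baseCycle * x, baseCycle ^ 2 * x, baseCycle ^ 3 * x, baseCycle ^ 4 * x]

/-- Representatives of the six pairs `{c, c⁻¹}` of `5`-cycles conjugate to `baseCycle` in `A₅`. -/
def axisCycle (j : Fin 6) : Equiv.Perm (Fin 5) :=
  axisTransversal j * baseCycle * (axisTransversal j)⁻¹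

theorem sign_baseCycle : Equiv.Perm.sign baseCycle = 1 := by decide +kernel

theorem sign_axisTransversal (j : Fin 6) : Equiv.Perm.sign (axisTransversal j) = 1 := by
  revert j; decide +kernel

theorem baseCycle_pow_five : baseCycle ^ 5 = 1 := by decide +kernel

theorem axisCycle_ne (j k : Fin 6) (h : j ≠ k) :
    axisCycle k ≠ axisCycle j ∧ axisCycle k ≠ (axisCycle j)⁻¹ := by
  revert j k; decide +kernel

theorem axisTransversal_zero : axisTransversal 0 = 1 := rfl

theorem axisCycle_zero : axisCycle 0 = baseCycle := by
  rw [axisCycle, axisTransversal_zero, one_mul, inv_one, mul_one]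

/-- An even permutation is a rotation followed by an even permutation fixing `0`. -/
theorem exists_eq_baseCycle_pow_mul (g : Equiv.Perm (Fin 5)) (hg : Equiv.Perm.sign g = 1) :
    ∃ (k : ℕ) (h : Equiv.Perm (Fin 5)), h 0 = 0 ∧ Equiv.Perm.sign h = 1 ∧
      g = baseCycle ^ k * h := by
  have rot : ∀ m : Fin 5, (baseCycle ^ (m : ℕ)) 0 = m := by decide +kernel
  refine ⟨(g 0 : ℕ), (baseCycle ^ (g 0 : ℕ))⁻¹ * g, ?_, ?_, by group⟩
  · rw [Equiv.Perm.mul_apply, Equiv.Perm.inv_eq_iff_eq, rot]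
  · simp [hg, sign_baseCycle]

theorem conj_baseCycle_pow_mul (k : ℕ) (h : Equiv.Perm (Fin 5)) :
    baseCycle ^ k * h * baseCycle * (baseCycle ^ k * h)⁻¹ =
      baseCycle ^ k * (h * baseCycle * h⁻¹) * (baseCycle ^ k)⁻¹ := by
  group

/-- In `A₅` the equation `x ^ 15 = 1` means odd order, and a sign character cannot be `-1` on such
an `x`. Hence in a stabilizer containing `baseCycle` with sign `1`, only elements inverting
`baseCycle` can have sign `-1`. -/
theorem conj_baseCycle_eq_inv_or_pow_eq_one (g : Equiv.Perm (Fin 5))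
    (hg : Equiv.Perm.sign g = 1) :
    g * baseCycle * g⁻¹ = baseCycle⁻¹ ∨ ∃ k : ℕ, (baseCycle ^ k * g) ^ 15 = 1 := by
  have key : ∀ h : Equiv.Perm (Fin 5), h 0 = 0 → Equiv.Perm.sign h = 1 →
      h * baseCycle * h⁻¹ = baseCycle⁻¹ ∨ ∃ k : Fin 5, (baseCycle ^ (k : ℕ) * h) ^ 15 = 1 := by
    decide +kernel
  obtain ⟨k, h, h0, hs, rfl⟩ := exists_eq_baseCycle_pow_mul g hg
  rcases key h h0 hs with h1 | ⟨l, hl⟩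
  · left
    rw [conj_baseCycle_pow_mul, h1]
    group
  · right
    -- Modulo 5, `4 * k` is `-k`, which cancels the rotation part of `g`.
    refine ⟨l + 4 * k, ?_⟩
    rw [← mul_assoc, ← pow_add, show (l : ℕ) + 4 * k + k = l + 5 * k by ring, pow_add, pow_mul,
      baseCycle_pow_five, one_pow, mul_one, hl]

theorem eq_pow_of_conj_baseCycle (g : Equiv.Perm (Fin 5))
    (hg : Equiv.Perm.sign g = 1) (h : g * baseCycle * g⁻¹ = baseCycle) :
    ∃ k : ℕ, g = baseCycle ^ k := by
  have key : ∀ h : Equiv.Perm (Fin 5), h 0 = 0 → h * baseCycle * h⁻¹ = baseCycle → h = 1 := by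
    decide +kernel
  obtain ⟨k, g, g0, hs, rfl⟩ := exists_eq_baseCycle_pow_mul g hg
  refine ⟨k, ?_⟩
  rw [conj_baseCycle_pow_mul, mul_inv_eq_iff_eq_mul, ← pow_succ', pow_succ, mul_right_inj] at h
  rw [key g g0 h, mul_one]

theorem exists_conj_axisCycle_eq (g : Equiv.Perm (Fin 5))
    (hg : Equiv.Perm.sign g = 1) (j : Fin 6) :
    ∃ i, g * axisCycle j * g⁻¹ = axisCycle i ∨ g * axisCycle j * g⁻¹ = (axisCycle i)⁻¹ := by
  have base : ∀ j, ∃ i, baseCycle * axisCycle j * baseCycle⁻¹ = axisCycle i := by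
    decide +kernel
  have key : ∀ h : Equiv.Perm (Fin 5), h 0 = 0 → Equiv.Perm.sign h = 1 → ∀ j,
      ∃ i, h * axisCycle j * h⁻¹ = axisCycle i ∨ h * axisCycle j * h⁻¹ = (axisCycle i)⁻¹ := by
    decide +kernel
  have pow : ∀ (k : ℕ) (j), ∃ i, baseCycle ^ k * axisCycle j * (baseCycle ^ k)⁻¹ = axisCycle i := by
    intro k
    induction k with
    | zero => exact fun j => ⟨j, by group⟩
    | succ k ih =>
      intro j
      obtain ⟨i, hi⟩ := base j
      obtain ⟨m, hm⟩ := ih i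
      refine ⟨m, ?_⟩
      rw [← hm, ← hi]
      group
  obtain ⟨k, h, h0, hs, rfl⟩ := exists_eq_baseCycle_pow_mul g hg
  obtain ⟨i, hi⟩ := key h h0 hs j
  obtain ⟨m, hm⟩ := pow k i
  refine ⟨m, hi.imp (fun hi => ?_) (fun hi => ?_)⟩ <;>
  · rw [← hm]
    simp only [mul_inv_rev, inv_inv, mul_assoc, mul_right_inj]
    rw [← mul_assoc, ← mul_assoc, mul_assoc h, ← mul_assoc h, hi]

theorem eq_one_of_conj_axisCycle (g : Equiv.Perm (Fin 5)) (hg : Equiv.Perm.sign g = 1)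
    (h : ∀ j, g * axisCycle j * g⁻¹ = axisCycle j) : g = 1 := by
  have key : ∀ k : Fin 5, baseCycle ^ (k : ℕ) * axisCycle 1 * (baseCycle ^ (k : ℕ))⁻¹ = axisCycle 1 →
      baseCycle ^ (k : ℕ) = 1 := by
    decide +kernel
  obtain ⟨k, rfl⟩ := eq_pow_of_conj_baseCycle g hg (axisCycle_zero ▸ h 0)
  have hk : baseCycle ^ k = baseCycle ^ (k % 5) := pow_eq_pow_mod k baseCycle_pow_five
  have h1 := h 1
  rw [hk] at h1 ⊢
  exact key ⟨k % 5, Nat.mod_lt _ (by norm_num)⟩ h1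

/-- Together with `exists_eq_baseCycle_pow_mul` this shows that `A₅` is generated by elements of odd
order. -/
theorem exists_axisCycle_mul_pow_eq_one (g : Equiv.Perm (Fin 5)) (h0 : g 0 = 0)
    (hg : Equiv.Perm.sign g = 1) : ∃ j, (axisCycle j * g) ^ 15 = 1 := by
  revert g; decide +kernel

/-- An even permutation of five letters, as an element of the icosahedral group. -/
def evenPerm (g : Equiv.Perm (Fin 5)) (hg : Equiv.Perm.sign g = 1) : Icosahedral :=
  ⟨g, Equiv.Perm.mem_alternatingGroup.2 hg⟩

theorem coe_evenPerm (g : Equiv.Perm (Fin 5)) (hg : Equiv.Perm.sign g = 1) :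
    (evenPerm g hg : Equiv.Perm (Fin 5)) = g := rfl

theorem sign_coe (g : Icosahedral) : Equiv.Perm.sign (g : Equiv.Perm (Fin 5)) = 1 :=
  Equiv.Perm.mem_alternatingGroup.1 g.2

/-! ### The standard monomial representation -/

/-- The coordinate vector of a `5`-cycle `c`, where `c⁻¹` is identified with `-c`. -/
def axisVec (c : Equiv.Perm (Fin 5)) (i : Fin 6) : ℤ :=
  (if c = axisCycle i then 1 else 0) - (if c = (axisCycle i)⁻¹ then 1 else 0)

theorem axisVec_inv (c : Equiv.Perm (Fin 5)) (i : Fin 6) : axisVec c⁻¹ i = -axisVec c i := by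
  simp only [axisVec, inv_eq_iff_eq_inv, inv_inv]
  ring

theorem axisVec_axisCycle (i j : Fin 6) : axisVec (axisCycle j) i = if i = j then 1 else 0 := by
  revert i j; decide +kernel

/-- An odd function of `5`-cycles is a linear function of the coordinate vector. -/
theorem sum_mul_axisVec {F : Equiv.Perm (Fin 5) → ℤ} (hF : ∀ c, F c⁻¹ = -F c)
    {c : Equiv.Perm (Fin 5)} (hc : ∃ l, c = axisCycle l ∨ c = (axisCycle l)⁻¹) :
    ∑ m, F (axisCycle m) * axisVec c m = F c := by
  obtain ⟨l, rfl | rfl⟩ := hc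
  · simp [axisVec_axisCycle]
  · simp [hF, axisVec_inv, axisVec_axisCycle]

theorem axisVec_conj_inv (g c : Equiv.Perm (Fin 5)) (i : Fin 6) :
    axisVec (g * c⁻¹ * g⁻¹) i = -axisVec (g * c * g⁻¹) i := by
  rw [← axisVec_inv, show g * c⁻¹ * g⁻¹ = (g * c * g⁻¹)⁻¹ by group]

/-- The matrix of the conjugation action of `g` on the `5`-cycles up to inversion. -/
def axisMatrix (g : Equiv.Perm (Fin 5)) : Matrix (Fin 6) (Fin 6) ℤ :=
  Matrix.of fun i j => axisVec (g * axisCycle j * g⁻¹) i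

theorem axisMatrix_apply (g : Equiv.Perm (Fin 5)) (i j : Fin 6) :
    axisMatrix g i j = axisVec (g * axisCycle j * g⁻¹) i := rfl

theorem axisMatrix_one : axisMatrix 1 = 1 := by
  ext i j
  rw [axisMatrix_apply, one_mul, inv_one, mul_one, axisVec_axisCycle, Matrix.one_apply]

theorem axisMatrix_mul (g h : Equiv.Perm (Fin 5)) (hh : Equiv.Perm.sign h = 1) :
    axisMatrix (g * h) = axisMatrix g * axisMatrix h := by
  ext i j
  have h1 := sum_mul_axisVec (F := fun c => axisVec (g * c * g⁻¹) i)
    (fun c => axisVec_conj_inv g c i) (exists_conj_axisCycle_eq h hh j)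
  rw [axisMatrix_apply, Matrix.mul_apply,
    show g * h * axisCycle j * (g * h)⁻¹ = g * (h * axisCycle j * h⁻¹) * g⁻¹ by group]
  exact h1.symm

theorem axisMatrix_inv (g : Equiv.Perm (Fin 5)) : axisMatrix g⁻¹ = (axisMatrix g).transpose := by
  ext i j
  rw [Matrix.transpose_apply, axisMatrix_apply, axisMatrix_apply, axisVec, axisVec]
  have e1 : g⁻¹ * axisCycle j * g⁻¹⁻¹ = axisCycle i ↔ g * axisCycle i * g⁻¹ = axisCycle j := by
    constructor <;> intro h <;> rw [← h] <;> group
  have e2 : g⁻¹ * axisCycle j * g⁻¹⁻¹ = (axisCycle i)⁻¹ ↔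
      g * axisCycle i * g⁻¹ = (axisCycle j)⁻¹ := by
    constructor
    · intro h
      have := congrArg (fun x => g * x⁻¹ * g⁻¹) h
      simp only [inv_inv] at this
      rw [← this]; group
    · intro h
      have := congrArg (fun x => g⁻¹ * x⁻¹ * g) h
      simp only [inv_inv] at this
      rw [inv_inv, ← this]; group
  simp only [e1, e2]

/-- The standard monomial representation of the icosahedral group. -/
def axisRep : Icosahedral →* B6 where
  toFun g := ⟨axisMatrix g, by
    rw [Matrix.mem_orthogonalGroup_iff, ← axisMatrix_inv, ← axisMatrix_mul _ _ (by rw [Equiv.Perm.sign_inv]; exact g.2), mul_inv_cancel,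
      axisMatrix_one]⟩
  map_one' := Subtype.ext axisMatrix_one
  map_mul' g h := Subtype.ext (axisMatrix_mul g h h.2)

theorem coe_axisRep (g : Icosahedral) : (axisRep g).1 = axisMatrix g := rfl

theorem eq_of_axisVec_eq_one {c : Equiv.Perm (Fin 5)} {i : Fin 6} (h : axisVec c i = 1) :
    c = axisCycle i := by
  by_contra hne
  rw [axisVec, if_neg hne] at h
  split_ifs at h <;> omega

theorem axisRep_injective : Function.Injective axisRep := by
  rw [injective_iff_map_eq_one]
  intro g hg
  refine Subtype.ext (eq_one_of_conj_axisCycle g g.2 fun j => eq_of_axisVec_eq_one ?_)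
  rw [← axisMatrix_apply, ← coe_axisRep, hg, Submonoid.coe_one, Matrix.one_apply_eq]

/-- The determinant is a homomorphism to `±1`; it is trivial on elements of odd order, and these
generate `A₅`. -/
theorem det_eq_one_of_hom (ρ : Icosahedral →* B6) (g : Icosahedral) : (ρ g).1.det = 1 := by
  obtain ⟨δ, hδ⟩ : ∃ δ : Icosahedral →* ℤ, ∀ x, δ x = (ρ x).1.det :=
    ⟨{ toFun := fun x => (ρ x).1.det
       map_one' := by rw [map_one, Submonoid.coe_one, Matrix.det_one]
       map_mul' := fun x y => by rw [map_mul, Submonoid.coe_mul, Matrix.det_mul] },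
      fun _ => by rw [MonoidHom.coe_mk, OneHom.coe_mk]⟩
  have hodd (x : Icosahedral) (hx : x ^ 15 = 1) : δ x = 1 := by
    have h := congrArg δ hx
    rw [map_pow, map_one] at h
    rcases Int.isUnit_iff.1 (IsUnit.of_pow_eq_one h (by norm_num)) with h1 | h1
    · exact h1
    · rw [h1] at h; norm_num at h
  have hsign (j : Fin 6) : Equiv.Perm.sign (axisCycle j) = 1 := by
    simp [axisCycle, sign_axisTransversal, sign_baseCycle]
  have hpow (j : Fin 6) : axisCycle j ^ 15 = 1 := by
    rw [axisCycle, conj_pow, show 15 = 5 * 3 by norm_num, pow_mul, baseCycle_pow_five, one_pow,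
      mul_one, mul_inv_cancel]
  have hc (j : Fin 6) : δ (evenPerm (axisCycle j) (hsign j)) = 1 := hodd _ (Subtype.ext (by
    rw [SubgroupClass.coe_pow, coe_evenPerm, hpow, Subgroup.coe_one]))
  obtain ⟨k, h, h0, hs, hg⟩ := exists_eq_baseCycle_pow_mul g g.2
  obtain ⟨j, hj⟩ := exists_axisCycle_mul_pow_eq_one h h0 hs
  have h1 : δ (evenPerm h hs) = 1 := by
    have h2 := hodd (evenPerm (axisCycle j) (hsign j) * evenPerm h hs) (Subtype.ext (by
      rw [SubgroupClass.coe_pow, Subgroup.coe_mul, coe_evenPerm, coe_evenPerm, hj,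
        Subgroup.coe_one]))
    rwa [map_mul, hc, one_mul] at h2
  have h3 : g = evenPerm (axisCycle 0) (hsign 0) ^ k * evenPerm h hs :=
    Subtype.ext (by
    rw [hg, Subgroup.coe_mul, SubgroupClass.coe_pow, coe_evenPerm, coe_evenPerm, axisCycle_zero])
  rw [← hδ, h3, map_mul, map_pow, hc, h1, one_pow, one_mul]

/-! ### Monomial representations without invariant vectors -/

theorem B6.apply_of_ne_zero {A : B6} {i j : Fin 6} (h : A.1 i j ≠ 0) (k : Fin 6) :
    A.1 k j = if k = i then A.1 i j else 0 := by
  obtain ⟨m, u, hu⟩ := A.exists_col_eq j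
  have hm : i = m := by
    by_contra hne
    exact h (by rw [hu, if_neg hne])
  rw [hu k, hu i, hm, if_pos rfl]

theorem B6.mul_apply_of_ne_zero (A : B6) {B : B6} {i j : Fin 6} (h : B.1 i j ≠ 0) (l : Fin 6) :
    (A * B).1 l j = A.1 l i * B.1 i j :=
  B6.mul_apply_of_col (B6.apply_of_ne_zero h) l

theorem B6.eq_zero_or_eq_one_or_eq_neg_one (A : B6) (i j : Fin 6) :
    A.1 i j = 0 ∨ A.1 i j = 1 ∨ A.1 i j = -1 := by
  obtain ⟨m, u, hu⟩ := A.exists_col_eq j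
  rw [hu]
  split_ifs
  · exact Or.inr ((Int.units_eq_one_or u).imp (by rintro rfl; rfl) (by rintro rfl; rfl))
  · exact Or.inl rfl

theorem B6.pow_apply_self {A : B6} {i : Fin 6} (h : A.1 i i ≠ 0) (n : ℕ) :
    (A ^ n).1 i i = A.1 i i ^ n := by
  induction n with
  | zero => rw [pow_zero, pow_zero, Submonoid.coe_one, Matrix.one_apply_eq]
  | succ n ih => rw [pow_succ, B6.mul_apply_of_ne_zero _ h, ih, pow_succ]

/-- A homomorphism with vanishing sum has a signed axis whose stabilizer is the stabilizer of
`{baseCycle, baseCycle⁻¹}`, the sign being the obvious one. -/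
theorem exists_axis_of_sum_eq_zero (ρ : Icosahedral →* B6) (h0 : ∀ i, ∑ g, (ρ g).1 i i = 0) :
    ∃ i, ∀ g : Icosahedral,
      ((ρ g).1 i i = 1 ↔ g.1 * baseCycle * g.1⁻¹ = baseCycle) ∧
      ((ρ g).1 i i = -1 ↔ g.1 * baseCycle * g.1⁻¹ = baseCycle⁻¹) := by
  let p : Icosahedral := evenPerm baseCycle sign_baseCycle
  have hp5 : p ^ 5 = 1 := Subtype.ext (by
    rw [SubgroupClass.coe_pow, coe_evenPerm, baseCycle_pow_five, Subgroup.coe_one])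
  obtain ⟨i, hi⟩ := B6.exists_apply_self_eq_one_of_pow_five (A := ρ p)
    (by rw [← map_pow, hp5, map_one])
  have mul_of (g : Icosahedral) {h : Icosahedral} (hh : (ρ h).1 i i ≠ 0) :
      (ρ (g * h)).1 i i = (ρ g).1 i i * (ρ h).1 i i := by
    rw [map_mul, B6.mul_apply_of_ne_zero _ hh]
  have pow_of {h : Icosahedral} (hh : (ρ h).1 i i ≠ 0) (n : ℕ) :
      (ρ (h ^ n)).1 i i = (ρ h).1 i i ^ n := by
    rw [map_pow, B6.pow_apply_self hh]
  have hpk (k : ℕ) : (ρ (p ^ k)).1 i i = 1 := by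
    rw [pow_of (by rw [hi]; norm_num), hi, one_pow]
  have one : (ρ 1).1 i i = 1 := by rw [map_one, Submonoid.coe_one, Matrix.one_apply_eq]
  have neg (g : Icosahedral) (hg : (ρ g).1 i i = -1) :
      g.1 * baseCycle * g.1⁻¹ = baseCycle⁻¹ := by
    rcases conj_baseCycle_eq_inv_or_pow_eq_one g.1 (sign_coe g) with h | ⟨k, hk⟩
    · exact h
    · exfalso
      have h1 : (p ^ k * g) ^ 15 = 1 := Subtype.ext (by
        rw [SubgroupClass.coe_pow, Subgroup.coe_mul, SubgroupClass.coe_pow, coe_evenPerm, hk,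
          Subgroup.coe_one])
      have h2 : (ρ (p ^ k * g)).1 i i = -1 := by
        rw [mul_of _ (by rw [hg]; norm_num), hpk, hg, one_mul]
      have h3 := pow_of (h := p ^ k * g) (by rw [h2]; norm_num) 15
      rw [h1, one, h2] at h3
      norm_num at h3
  -- Without an entry `-1` the sum would be positive, the identity contributing `1`.
  obtain ⟨d, hd⟩ : ∃ d, (ρ d).1 i i = -1 := by
    by_contra! hne
    have hpos : 0 < ∑ g, (ρ g).1 i i := by
      refine Finset.sum_pos' (fun g _ => ?_) ⟨1, Finset.mem_univ _, by rw [one]; norm_num⟩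
      rcases (ρ g).eq_zero_or_eq_one_or_eq_neg_one i i with h | h | h
      · exact h.ge
      · rw [h]; norm_num
      · exact absurd h (hne g)
    exact hpos.ne' (h0 i)
  have hd0 : (ρ d).1 i i ≠ 0 := by rw [hd]; norm_num
  have hdp := neg d hd
  have pos (g : Icosahedral) (hg : (ρ g).1 i i = 1) : g.1 * baseCycle * g.1⁻¹ = baseCycle := by
    -- Both `d` and `g * d` invert `baseCycle`, so `g` centralizes it.
    have h1 := neg (g * d) (by rw [mul_of _ hd0, hg, hd, one_mul])
    have h2 : (g * d).1 * baseCycle * (g * d).1⁻¹ = (g.1 * baseCycle * g.1⁻¹)⁻¹ := by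
      have e : (g * d).1 * baseCycle * (g * d).1⁻¹ = g.1 * (d.1 * baseCycle * d.1⁻¹) * g.1⁻¹ := by
        rw [Subgroup.coe_mul]; group
      rw [e, hdp]; group
    rwa [h2, inv_inj] at h1
  have pos' (g : Icosahedral) (hg : g.1 * baseCycle * g.1⁻¹ = baseCycle) :
      (ρ g).1 i i = 1 := by
    obtain ⟨k, hk⟩ := eq_pow_of_conj_baseCycle g.1 (sign_coe g) hg
    have : g = p ^ k := Subtype.ext (by rw [hk, SubgroupClass.coe_pow, coe_evenPerm])
    rw [this, hpk]
  refine ⟨i, fun g => ⟨⟨pos g, pos' g⟩, ⟨neg g, fun hg => ?_⟩⟩⟩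
  have hdp' : d.1⁻¹ * baseCycle * d.1 = baseCycle⁻¹ := by
    have := congrArg (fun x => d.1⁻¹ * x⁻¹ * d.1) hdp
    simp only [inv_inv] at this
    rw [← this]; group
  have h1 : (g * d⁻¹).1 * baseCycle * (g * d⁻¹).1⁻¹ = baseCycle := by
    have e : (g * d⁻¹).1 * baseCycle * (g * d⁻¹).1⁻¹ =
        g.1 * (d.1⁻¹ * baseCycle * d.1) * g.1⁻¹ := by
      rw [Subgroup.coe_mul, Subgroup.coe_inv]; group
    rw [e, hdp', show g.1 * baseCycle⁻¹ * g.1⁻¹ = (g.1 * baseCycle * g.1⁻¹)⁻¹ by group, hg, inv_inv]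
  have h2 := mul_of (g * d⁻¹) hd0
  rwa [inv_mul_cancel_right, pos' _ h1, hd, one_mul] at h2

/-- A homomorphism from the icosahedral group to `B₆` with vanishing sum is conjugate to the
standard one. -/
theorem exists_conj_axisRep (ρ : Icosahedral →* B6) (h0 : ∀ i, ∑ g, (ρ g).1 i i = 0) :
    ∃ M : B6, ∀ g, ρ g * M = M * axisRep g := by
  obtain ⟨i, hi⟩ := exists_axis_of_sum_eq_zero ρ h0
  let t (j : Fin 6) : Icosahedral := evenPerm (axisTransversal j) (sign_axisTransversal j)
  have ht (g : Icosahedral) (j l : Fin 6) : ((t l)⁻¹ * g * t j).1 * baseCycle *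
      ((t l)⁻¹ * g * t j).1⁻¹ =
        (axisTransversal l)⁻¹ * (g.1 * axisCycle j * g.1⁻¹) * axisTransversal l := by
    rw [Subgroup.coe_mul, Subgroup.coe_mul, Subgroup.coe_inv, coe_evenPerm, coe_evenPerm,
      axisCycle]
    group
  have hpos (g : Icosahedral) (j l : Fin 6) :
      (ρ ((t l)⁻¹ * g * t j)).1 i i = 1 ↔ g.1 * axisCycle j * g.1⁻¹ = axisCycle l := by
    rw [(hi _).1, ht, axisCycle.eq_1 l]
    constructor
    · intro h
      rw [← h]; group
    · intro h
      rw [h]; group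
  have hneg (g : Icosahedral) (j l : Fin 6) :
      (ρ ((t l)⁻¹ * g * t j)).1 i i = -1 ↔ g.1 * axisCycle j * g.1⁻¹ = (axisCycle l)⁻¹ := by
    rw [(hi _).2, ht, axisCycle.eq_1 l]
    constructor
    · intro h
      rw [← inv_inj] at h
      rw [← inv_inj, inv_inv, ← inv_inv baseCycle, ← h]; group
    · intro h
      rw [h]; group
  -- Column `j` is the image of the distinguished basis vector under `ρ (t j)`. Orthogonality and
  -- intertwining both reduce to the sign of `(t l)⁻¹ * g * t j` at that vector, known from `hpos`
  -- and `hneg`.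
  let m : Matrix (Fin 6) (Fin 6) ℤ := Matrix.of fun k j => (ρ (t j)).1 k i
  have hm (k j : Fin 6) : m k j = (ρ (t j)).1 k i := rfl
  have hgram : m.transpose * m = 1 := by
    ext l j
    have e : (m.transpose * m) l j = (ρ ((t l)⁻¹ * 1 * t j)).1 i i := by
      rw [mul_one, map_mul, map_inv, Submonoid.coe_mul, B6.coe_inv, Matrix.mul_apply,
        Matrix.mul_apply]
      rfl
    rw [e]
    by_cases hlj : l = j
    · rw [hlj, Matrix.one_apply_eq, hpos, Subgroup.coe_one]
      group
    · rw [Matrix.one_apply_ne hlj]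
      have h1 := hpos 1 j l
      have h2 := hneg 1 j l
      rw [Subgroup.coe_one, one_mul, inv_one, mul_one] at h1 h2
      rcases (ρ ((t l)⁻¹ * 1 * t j)).eq_zero_or_eq_one_or_eq_neg_one i i with h | h | h
      · exact h
      · exact absurd (h1.1 h) (axisCycle_ne l j hlj).1
      · exact absurd (h2.1 h) (axisCycle_ne l j hlj).2
  refine ⟨⟨m, (Matrix.mem_orthogonalGroup_iff' _ _).2 hgram⟩, fun g => Subtype.ext ?_⟩
  ext k j
  have hl : (ρ g * ⟨m, (Matrix.mem_orthogonalGroup_iff' _ _).2 hgram⟩ : B6).1 k j =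
      (ρ (g * t j)).1 k i := by
    rw [map_mul, Submonoid.coe_mul, Submonoid.coe_mul, Matrix.mul_apply, Matrix.mul_apply]
    rfl
  have hr : ((⟨m, (Matrix.mem_orthogonalGroup_iff' _ _).2 hgram⟩ : B6) * axisRep g).1 k j =
      ∑ l, m k l * axisVec (g.1 * axisCycle j * g.1⁻¹) l := by
    rw [Submonoid.coe_mul, Matrix.mul_apply]
    rfl
  rw [hl, hr]
  obtain ⟨l, h | h⟩ := exists_conj_axisCycle_eq g.1 (sign_coe g) j
  · have h1 := (hpos g j l).2 h
    have e : g * t j = t l * ((t l)⁻¹ * g * t j) := by group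
    rw [e, map_mul, B6.mul_apply_of_ne_zero _ (by rw [h1]; norm_num), h1, h]
    simp [axisVec_axisCycle, hm]
  · have h1 := (hneg g j l).2 h
    have e : g * t j = t l * ((t l)⁻¹ * g * t j) := by group
    rw [e, map_mul, B6.mul_apply_of_ne_zero _ (by rw [h1]; norm_num), h1, h]
    simp [axisVec_inv, axisVec_axisCycle, hm]

/-- If the character of a homomorphism to `B₆` sums to zero, then so does the homomorphism. -/
theorem sum_eq_zero_of_sum_trace_eq_zero (ρ : Icosahedral →* B6)
    (h : ∑ g, (ρ g).1.trace = 0) : ∑ g, (ρ g).1 = 0 := by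
  set P := ∑ g, (ρ g).1 with hP
  have h1 (x : Icosahedral) : (ρ x).1.transpose * P = P := by
    rw [hP, Finset.mul_sum]
    refine Fintype.sum_equiv (Equiv.mulLeft x⁻¹) _ _ fun g => ?_
    rw [Equiv.coe_mulLeft, map_mul, map_inv, Submonoid.coe_mul, B6.coe_inv]
  -- `P` is the group order times the projection onto invariants, so the sum of squares of its
  -- entries is a multiple of its trace, which is zero.
  have h2 : P.transpose * P = (Fintype.card Icosahedral) • P := by
    conv_lhs => rw [hP, Matrix.transpose_sum, Finset.sum_mul, ← hP]
    rw [Finset.sum_congr rfl fun x _ => h1 x, Finset.sum_const, Finset.card_univ]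
  have h3 : (P.transpose * P).trace = 0 := by
    rw [h2, Matrix.trace_smul, hP, Matrix.trace_sum, h, smul_zero]
  have h4 : ∑ j, ∑ i, P i j * P i j = 0 := h3
  ext i j
  rw [Finset.sum_eq_zero_iff_of_nonneg
    fun j _ => Finset.sum_nonneg fun i _ => mul_self_nonneg _] at h4
  have h5 := h4 j (Finset.mem_univ j)
  rw [Finset.sum_eq_zero_iff_of_nonneg fun i _ => mul_self_nonneg _] at h5
  exact mul_self_eq_zero.1 (h5 i (Finset.mem_univ i))

/-! ### The two three-dimensional representations -/

/-- The sign of the inner product of the axes of two `5`-cycles. -/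
def cycleSign (c c' : Equiv.Perm (Fin 5)) : ℤ :=
  (if (c * c') ^ 3 = 1 then 1 else 0) - (if (c * c'⁻¹) ^ 3 = 1 then 1 else 0)

theorem cycleSign_inv_right (c c' : Equiv.Perm (Fin 5)) :
    cycleSign c c'⁻¹ = -cycleSign c c' := by
  rw [cycleSign, cycleSign, inv_inv]
  ring

theorem cycleSign_comm (c c' : Equiv.Perm (Fin 5)) : cycleSign c c' = cycleSign c' c := by
  have h1 : (c * c') ^ 3 = 1 ↔ (c' * c) ^ 3 = 1 := by
    rw [show c * c' = c'⁻¹ * (c' * c) * c'⁻¹⁻¹ by group, conj_pow, conj_eq_one_iff]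
  have h2 : (c * c'⁻¹) ^ 3 = 1 ↔ (c' * c⁻¹) ^ 3 = 1 := by
    rw [show c * c'⁻¹ = (c' * c⁻¹)⁻¹ by group, inv_pow, inv_eq_one]
  simp only [cycleSign, h1, h2]

theorem cycleSign_conj (g c c' : Equiv.Perm (Fin 5)) :
    cycleSign (g * c * g⁻¹) (g * c' * g⁻¹) = cycleSign c c' := by
  have h1 : (g * c * g⁻¹ * (g * c' * g⁻¹)) ^ 3 = 1 ↔ (c * c') ^ 3 = 1 := by
    rw [show g * c * g⁻¹ * (g * c' * g⁻¹) = g * (c * c') * g⁻¹ by group, conj_pow,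
      conj_eq_one_iff]
  have h2 : (g * c * g⁻¹ * (g * c' * g⁻¹)⁻¹) ^ 3 = 1 ↔ (c * c'⁻¹) ^ 3 = 1 := by
    rw [show g * c * g⁻¹ * (g * c' * g⁻¹)⁻¹ = g * (c * c'⁻¹) * g⁻¹ by group, conj_pow,
      conj_eq_one_iff]
  simp only [cycleSign, h1, h2]

/-- The matrix of signs of inner products of the six axes, with `-1` on the diagonal. -/
def axisSignMatrix : Matrix (Fin 6) (Fin 6) ℤ :=
  !![-1, -1, -1, -1, -1, -1; -1, -1, 1, -1, -1, 1; -1, 1, -1, 1, -1, -1;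
    -1, -1, 1, -1, 1, -1; -1, -1, -1, 1, -1, 1; -1, 1, -1, -1, 1, -1]

/-- For cycles on different axes exactly one of `c * c'` and `c * c'⁻¹` has order 3; for `c = c'`
only the second has trivial cube, whence the diagonal `-1`. Signs defined by orders are visibly
invariant under conjugation. -/
theorem axisSignMatrix_apply (i j : Fin 6) :
    axisSignMatrix i j = cycleSign (axisCycle i) (axisCycle j) := by
  have h : axisSignMatrix = Matrix.of fun i j => cycleSign (axisCycle i) (axisCycle j) := by
    decide +kernel
  rw [h, Matrix.of_apply]

/-- By oddness of `cycleSign`, both products evaluate to the sign between axis `i` and the image of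
axis `j` under `g`; invariance under conjugation moves `g` from one argument to the other. -/
theorem axisSignMatrix_mul_axisMatrix (g : Equiv.Perm (Fin 5)) (hg : Equiv.Perm.sign g = 1) :
    axisSignMatrix * axisMatrix g = axisMatrix g * axisSignMatrix := by
  have hg' : Equiv.Perm.sign g⁻¹ = 1 := by rw [Equiv.Perm.sign_inv, hg]
  ext i j
  have h1 : (axisSignMatrix * axisMatrix g) i j =
      cycleSign (axisCycle i) (g * axisCycle j * g⁻¹) := by
    rw [Matrix.mul_apply, ← sum_mul_axisVec (cycleSign_inv_right (axisCycle i))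
      (exists_conj_axisCycle_eq g hg j)]
    exact Finset.sum_congr rfl fun m _ => by rw [axisSignMatrix_apply, axisMatrix_apply]
  have h2 : (axisMatrix g * axisSignMatrix) i j =
      cycleSign (axisCycle j) (g⁻¹ * axisCycle i * g⁻¹⁻¹) := by
    rw [Matrix.mul_apply, ← sum_mul_axisVec (cycleSign_inv_right (axisCycle j))
      (exists_conj_axisCycle_eq g⁻¹ hg' i)]
    refine Finset.sum_congr rfl fun m _ => ?_
    rw [axisSignMatrix_apply, cycleSign_comm, ← axisMatrix_apply, axisMatrix_inv,
      Matrix.transpose_apply, mul_comm]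
  rw [h1, h2, cycleSign_comm, ← cycleSign_conj g (axisCycle j)]
  congr 1
  group

/-- The six axes of the icosahedron, with `φ` the golden ratio or its conjugate. -/
def axisFrame (φ : ℝ) : Matrix (Fin 3) (Fin 6) ℝ :=
  !![0, 0, -φ, -1, 1, φ; 1, 1, 0, -φ, -φ, 0; φ, -φ, -1, 0, 0, -1]

theorem axisFrame_mul_transpose {φ : ℝ} (hφ : φ ^ 2 = φ + 1) :
    axisFrame φ * (axisFrame φ).transpose = (2 * φ + 4) • (1 : Matrix (Fin 3) (Fin 3) ℝ) := by
  ext i j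
  fin_cases i <;> fin_cases j <;>
    simp [axisFrame, Matrix.mul_apply, Fin.sum_univ_succ] <;> linarith

/-- Each axis vector has squared length `1 + φ² = φ + 2`, and different ones have inner product
`±φ`. The diagonal `-1` of the sign matrix turns `φ + 2` into `2 * φ + 2`. -/
theorem transpose_mul_axisFrame {φ : ℝ} (hφ : φ ^ 2 = φ + 1) :
    (axisFrame φ).transpose * axisFrame φ =
      (2 * φ + 2) • (1 : Matrix (Fin 6) (Fin 6) ℝ) + φ • axisSignMatrix.map (Int.castRingHom ℝ) := by
  ext i j
  fin_cases i <;> fin_cases j <;>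
    simp [axisFrame, axisSignMatrix, Matrix.mul_apply, Fin.sum_univ_succ] <;> linarith

/-- The matrix of `axisRep` over the real numbers. -/
def realAxisMatrix (g : Icosahedral) : Matrix (Fin 6) (Fin 6) ℝ :=
  (axisRep g).1.map (Int.castRingHom ℝ)

theorem realAxisMatrix_one : realAxisMatrix 1 = 1 := by
  rw [realAxisMatrix, map_one, Submonoid.coe_one]
  exact Matrix.map_one _ (map_zero _) (map_one _)

theorem realAxisMatrix_mul (g h : Icosahedral) :
    realAxisMatrix (g * h) = realAxisMatrix g * realAxisMatrix h := by
  rw [realAxisMatrix, map_mul, Submonoid.coe_mul, Matrix.map_mul]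
  rfl

theorem gram_mul_realAxisMatrix {φ : ℝ} (hφ : φ ^ 2 = φ + 1) (g : Icosahedral) :
    (axisFrame φ).transpose * axisFrame φ * realAxisMatrix g =
      realAxisMatrix g * ((axisFrame φ).transpose * axisFrame φ) := by
  have h := congrArg (fun A => A.map (Int.castRingHom ℝ))
    (axisSignMatrix_mul_axisMatrix g (sign_coe g))
  simp only [Matrix.map_mul] at h
  rw [transpose_mul_axisFrame hφ, Matrix.add_mul, Matrix.mul_add, Matrix.smul_mul, Matrix.mul_smul,
    Matrix.smul_mul, Matrix.mul_smul, one_mul, mul_one, realAxisMatrix, coe_axisRep, h]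

theorem two_mul_add_four_ne_zero {φ : ℝ} (hφ : φ ^ 2 = φ + 1) : 2 * φ + 4 ≠ 0 := by
  intro h
  have : φ = -2 := by linarith
  rw [this] at hφ
  norm_num at hφ

/-- The three-dimensional representation acting on the axes of the icosahedron. -/
noncomputable def icosahedralRep {φ : ℝ} (hφ : φ ^ 2 = φ + 1) :
    Representation ℝ Icosahedral (Fin 3 → ℝ) where
  toFun g := Matrix.toLin' ((2 * φ + 4)⁻¹ •
    (axisFrame φ * realAxisMatrix g * (axisFrame φ).transpose))
  map_one' := by
    rw [realAxisMatrix_one, Matrix.mul_one, axisFrame_mul_transpose hφ, smul_smul,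
      inv_mul_cancel₀ (two_mul_add_four_ne_zero hφ), one_smul, Matrix.toLin'_one]
    rfl
  -- The Gram matrix is a multiple of the projection onto the row space of the frame; it commutes
  -- with the action, so compression to this space is multiplicative.
  map_mul' g h := by
    rw [Module.End.mul_eq_comp, ← Matrix.toLin'_mul, Matrix.smul_mul, Matrix.mul_smul]
    congr 2
    have e : axisFrame φ * realAxisMatrix g * (axisFrame φ).transpose *
        (axisFrame φ * realAxisMatrix h * (axisFrame φ).transpose) =
        axisFrame φ * realAxisMatrix g * ((axisFrame φ).transpose * axisFrame φ *
          realAxisMatrix h) * (axisFrame φ).transpose := by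
      simp only [Matrix.mul_assoc]
    rw [e, gram_mul_realAxisMatrix hφ, realAxisMatrix_mul]
    have e' : axisFrame φ * realAxisMatrix g * (realAxisMatrix h *
        ((axisFrame φ).transpose * axisFrame φ)) * (axisFrame φ).transpose =
        axisFrame φ * (realAxisMatrix g * realAxisMatrix h) * (axisFrame φ).transpose *
          (axisFrame φ * (axisFrame φ).transpose) := by
      simp only [Matrix.mul_assoc]
    rw [e', axisFrame_mul_transpose hφ, Matrix.mul_smul, mul_one, smul_smul,
      inv_mul_cancel₀ (two_mul_add_four_ne_zero hφ), one_smul]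

theorem icosahedralRep_apply {φ : ℝ} (hφ : φ ^ 2 = φ + 1) (g : Icosahedral) :
    icosahedralRep hφ g = Matrix.toLin' ((2 * φ + 4)⁻¹ •
      (axisFrame φ * realAxisMatrix g * (axisFrame φ).transpose)) := rfl

theorem icosahedralRep_eq_toLin' {φ : ℝ} (hφ : φ ^ 2 = φ + 1) {g : Icosahedral}
    {D : Matrix (Fin 3) (Fin 3) ℝ} (h : axisFrame φ * realAxisMatrix g = D * axisFrame φ) :
    icosahedralRep hφ g = Matrix.toLin' D := by
  rw [icosahedralRep_apply, h, Matrix.mul_assoc, axisFrame_mul_transpose hφ, Matrix.mul_smul,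
    mul_one, smul_smul, inv_mul_cancel₀ (two_mul_add_four_ne_zero hφ), one_smul]

theorem character_icosahedralRep {φ : ℝ} (hφ : φ ^ 2 = φ + 1) (g : Icosahedral) :
    (icosahedralRep hφ).character g = (2 * φ + 4)⁻¹ * ((2 * φ + 2) * ((axisRep g).1.trace : ℝ) +
      φ * ((axisSignMatrix * (axisRep g).1).trace : ℝ)) := by
  have hcast (A : Matrix (Fin 6) (Fin 6) ℤ) :
      (A.map (Int.castRingHom ℝ)).trace = (A.trace : ℝ) := by
    simp [Matrix.trace]
  rw [Representation.character, icosahedralRep_apply, Matrix.trace_toLin'_eq, Matrix.trace_smul,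
    Matrix.trace_mul_comm, ← Matrix.mul_assoc, transpose_mul_axisFrame hφ, Matrix.add_mul,
    Matrix.smul_mul, Matrix.smul_mul, one_mul, Matrix.trace_add, Matrix.trace_smul,
    Matrix.trace_smul, realAxisMatrix, ← Matrix.map_mul, hcast, hcast, smul_eq_mul, smul_eq_mul,
    smul_eq_mul]

/-- This value tells the two roots apart, so the two representations are inequivalent. -/
theorem character_icosahedralRep_baseCycle {φ : ℝ} (hφ : φ ^ 2 = φ + 1) :
    (icosahedralRep hφ).character (evenPerm baseCycle sign_baseCycle) = φ := by
  have h1 : (axisMatrix baseCycle).trace = 1 := by decide +kernel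
  have h2 : (axisSignMatrix * axisMatrix baseCycle).trace = 4 := by decide +kernel
  rw [character_icosahedralRep, coe_axisRep, coe_evenPerm, h1, h2,
    inv_mul_eq_iff_eq_mul₀ (two_mul_add_four_ne_zero hφ)]
  push_cast
  linear_combination (-2) * hφ

theorem exists_icosahedralRep_eq_diagonal {φ : ℝ} (hφ : φ ^ 2 = φ + 1) :
    ∃ g, icosahedralRep hφ g = Matrix.toLin' !![1, 0, 0; 0, -1, 0; 0, 0, -1] := by
  have hs : Equiv.Perm.sign (Equiv.swap 0 4 * Equiv.swap 1 3 : Equiv.Perm (Fin 5)) = 1 := by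
    decide +kernel
  have hm : axisMatrix (Equiv.swap 0 4 * Equiv.swap 1 3) =
      !![-1, 0, 0, 0, 0, 0; 0, -1, 0, 0, 0, 0; 0, 0, 0, 0, 0, -1;
        0, 0, 0, 0, -1, 0; 0, 0, 0, -1, 0, 0; 0, 0, -1, 0, 0, 0] := by
    decide +kernel
  refine ⟨evenPerm _ hs, icosahedralRep_eq_toLin' hφ ?_⟩
  rw [realAxisMatrix, coe_axisRep, coe_evenPerm, hm]
  ext i j
  fin_cases i <;> fin_cases j <;>
    simp [axisFrame, Matrix.mul_apply, Fin.sum_univ_succ]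

theorem exists_icosahedralRep_eq_cyclic {φ : ℝ} (hφ : φ ^ 2 = φ + 1) :
    ∃ g, icosahedralRep hφ g = Matrix.toLin' !![0, 1, 0; 0, 0, 1; 1, 0, 0] := by
  have hs : Equiv.Perm.sign (Equiv.swap 1 3 * Equiv.swap 3 4 : Equiv.Perm (Fin 5)) = 1 := by
    decide +kernel
  have hm : axisMatrix (Equiv.swap 1 3 * Equiv.swap 3 4) =
      !![0, 0, -1, 0, 0, 0; 0, 0, 0, 0, 0, -1; 0, 0, 0, 1, 0, 0;
        -1, 0, 0, 0, 0, 0; 0, 1, 0, 0, 0, 0; 0, 0, 0, 0, -1, 0] := by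
    decide +kernel
  refine ⟨evenPerm _ hs, icosahedralRep_eq_toLin' hφ ?_⟩
  rw [realAxisMatrix, coe_axisRep, coe_evenPerm, hm]
  ext i j
  fin_cases i <;> fin_cases j <;>
    simp [axisFrame, Matrix.mul_apply, Fin.sum_univ_succ]

/-- If `w 0 ≠ 0`, adding to `w` its image under the half turn isolates the first basis vector, and
the cyclic rotation yields the other two. The same rotation brings any nonzero coordinate of a
vector into position 0. -/
theorem isIrreducible_icosahedralRep {φ : ℝ} (hφ : φ ^ 2 = φ + 1) :
    (icosahedralRep hφ).IsIrreducible := by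
  obtain ⟨d, hd⟩ := exists_icosahedralRep_eq_diagonal hφ
  obtain ⟨t, ht⟩ := exists_icosahedralRep_eq_cyclic hφ
  have hd' (w : Fin 3 → ℝ) : icosahedralRep hφ d w = ![w 0, -w 1, -w 2] := by
    rw [hd, Matrix.toLin'_apply]
    ext i
    fin_cases i <;> simp [Matrix.mulVec, dotProduct, Fin.sum_univ_succ]
  have ht' (w : Fin 3 → ℝ) : icosahedralRep hφ t w = ![w 1, w 2, w 0] := by
    rw [ht, Matrix.toLin'_apply]
    ext i
    fin_cases i <;> simp [Matrix.mulVec, dotProduct, Fin.sum_univ_succ]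
  have key (W : Subrepresentation (icosahedralRep hφ)) (w : Fin 3 → ℝ)
      (hw : w ∈ W.toSubmodule) (h0 : w 0 ≠ 0) : W.toSubmodule = ⊤ := by
    have e0 : ![1, 0, 0] ∈ W.toSubmodule := by
      have h := W.toSubmodule.smul_mem (2 * w 0)⁻¹
        (W.toSubmodule.add_mem hw (W.apply_mem_toSubmodule d hw))
      convert h using 1
      rw [hd']
      ext i
      fin_cases i <;> simp [Matrix.vecHead, Matrix.vecTail]
      field_simp
      norm_num
    have e2 := W.apply_mem_toSubmodule t e0
    have e1 := W.apply_mem_toSubmodule t e2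
    rw [ht' ![1, 0, 0]] at e1 e2
    rw [ht'] at e1
    rw [eq_top_iff]
    intro v _
    have hv := W.toSubmodule.add_mem (W.toSubmodule.add_mem (W.toSubmodule.smul_mem (v 0) e0)
      (W.toSubmodule.smul_mem (v 1) e1)) (W.toSubmodule.smul_mem (v 2) e2)
    convert hv using 1
    ext i
    fin_cases i <;> simp
  refine { exists_pair_ne := ⟨⊥, ⊤, fun h => ?_⟩, eq_bot_or_eq_top := fun W => ?_ }
  · have h1 := congrArg Subrepresentation.toSubmodule h
    exact bot_ne_top (α := Submodule ℝ (Fin 3 → ℝ)) h1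
  · by_cases hW : ∀ w ∈ W.toSubmodule, w = 0
    · left
      exact Subrepresentation.toSubmodule_injective ((Submodule.eq_bot_iff _).2 hW)
    · right
      push Not at hW
      obtain ⟨w, hw, hne⟩ := hW
      refine Subrepresentation.toSubmodule_injective ?_
      have hw1 := W.apply_mem_toSubmodule t hw
      have hw2 := W.apply_mem_toSubmodule t hw1
      by_cases h0 : w 0 = 0
      · by_cases h1 : w 1 = 0
        · have h2 : w 2 ≠ 0 := by
            intro h2
            apply hne
            ext i
            fin_cases i <;> simp [h0, h1, h2]
          exact key W _ hw2 (by simpa [ht'] using h2)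
        · exact key W _ hw1 (by simpa [ht'] using h1)
      · exact key W w hw h0

/-- The relations `φ + ψ = 1` and `φ * ψ = -1` say that the two projections sum to the identity: in
the sum of characters the sign matrix cancels (`h5`) and the trace gets coefficient 1 (`h6`). -/
theorem isCrystallographicRep_range_axisRep : IsCrystallographicRep axisRep.range := by
  have hφ : Real.goldenRatio ^ 2 = Real.goldenRatio + 1 := Real.goldenRatio_sq
  have hψ : Real.goldenConj ^ 2 = Real.goldenConj + 1 := Real.goldenConj_sq
  refine ⟨MonoidHom.ofInjective axisRep_injective, icosahedralRep hφ, icosahedralRep hψ,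
    isIrreducible_icosahedralRep hφ, isIrreducible_icosahedralRep hψ, ⟨fun f => ?_⟩, fun g => ?_⟩
  · have h := congrFun (Representation.char_iso f) (evenPerm baseCycle sign_baseCycle)
    rw [character_icosahedralRep_baseCycle, character_icosahedralRep_baseCycle] at h
    have h1 := Real.goldenRatio_pos
    have h2 := Real.goldenConj_neg
    linarith
  · rw [character_icosahedralRep, character_icosahedralRep, MonoidHom.ofInjective_apply]
    have h1 := two_mul_add_four_ne_zero hφ
    have h2 := two_mul_add_four_ne_zero hψ
    have h3 := Real.goldenRatio_add_goldenConj
    have h4 := Real.goldenRatio_mul_goldenConj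
    generalize Real.goldenRatio = φ at *
    generalize Real.goldenConj = ψ at *
    have h5 : (2 * φ + 4)⁻¹ * φ + (2 * ψ + 4)⁻¹ * ψ = 0 := by
      field_simp
      linear_combination 4 * h3 + 4 * h4
    have h6 : (2 * φ + 4)⁻¹ * (2 * φ + 2) + (2 * ψ + 4)⁻¹ * (2 * ψ + 2) = 1 := by
      field_simp
      linear_combination 4 * h3 + 4 * h4
    linear_combination (-((axisRep g).1.trace : ℝ)) * h6 -
      ((axisSignMatrix * (axisRep g).1).trace : ℝ) * h5

/-! ### The normalizer of the standard icosahedral subgroup -/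

/-- The matrix sending the axis of `c` to the axis of `τ c³ τ⁻¹`, where `τ` is the odd
permutation `x ↦ 2x` of `ℤ/5`. -/
def outerMatrix : Matrix (Fin 6) (Fin 6) ℤ :=
  !![1, 0, 0, 0, 0, 0; 0, 0, 0, 0, 0, -1; 0, 0, 0, -1, 0, 0;
    0, -1, 0, 0, 0, 0; 0, 0, 0, 0, -1, 0; 0, 0, -1, 0, 0, 0]

/-- `outerMatrix` as an element of `B₆`. -/
def outerElement : B6 :=
  ⟨outerMatrix, (Matrix.mem_orthogonalGroup_iff' _ _).2 (by
    change outerMatrix.transpose * outerMatrix = 1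
    decide +kernel)⟩

theorem det_outerElement : outerElement.1.det = 1 := by
  have h : outerMatrix = Matrix.diagonal ![1, -1, -1, -1, -1, -1] *
      (Equiv.swap (1 : Fin 6) 5 * Equiv.swap 5 2 * Equiv.swap 2 3).permMatrix ℤ := by
    decide +kernel
  change outerMatrix.det = 1
  rw [h, Matrix.det_mul, Matrix.det_diagonal, Matrix.det_permutation]
  decide +kernel

/-- The odd permutation `x ↦ 2x` of `ℤ/5`. -/
def doubling : Equiv.Perm (Fin 5) where
  toFun := ![0, 2, 4, 1, 3]
  invFun := ![0, 3, 1, 4, 2]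
  left_inv := by decide
  right_inv := by decide

theorem outerMatrix_apply (i j : Fin 6) :
    outerMatrix i j = axisVec (doubling * axisCycle j ^ 3 * doubling⁻¹) i := by
  have h : outerMatrix =
      Matrix.of fun i j => axisVec (doubling * axisCycle j ^ 3 * doubling⁻¹) i := by
    decide +kernel
  rw [h, Matrix.of_apply]

theorem doubling_conj_pow_three (j : Fin 6) :
    ∃ l, doubling * axisCycle j ^ 3 * doubling⁻¹ = axisCycle l ∨
      doubling * axisCycle j ^ 3 * doubling⁻¹ = (axisCycle l)⁻¹ := by
  revert j; decide +kernel

/-- Cubing exchanges the two `A₅`-classes of 5-cycles and conjugation by the odd `doubling`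
exchanges them back. The composite permutes the signed axes and intertwines `g` with its conjugate
by `doubling`. -/
theorem outerMatrix_mul_axisMatrix (g : Equiv.Perm (Fin 5)) (hg : Equiv.Perm.sign g = 1) :
    outerMatrix * axisMatrix g = axisMatrix (doubling * g * doubling⁻¹) * outerMatrix := by
  ext i j
  have h1 := sum_mul_axisVec (F := fun c => axisVec (doubling * c ^ 3 * doubling⁻¹) i)
    (fun c => by rw [inv_pow, axisVec_conj_inv]) (exists_conj_axisCycle_eq g hg j)
  have h2 := sum_mul_axisVec
    (F := fun c => axisVec ((doubling * g * doubling⁻¹) * c * (doubling * g * doubling⁻¹)⁻¹) i)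
    (fun c => axisVec_conj_inv _ c i) (doubling_conj_pow_three j)
  have e : doubling * (g * axisCycle j * g⁻¹) ^ 3 * doubling⁻¹ =
      doubling * g * doubling⁻¹ * (doubling * axisCycle j ^ 3 * doubling⁻¹) *
        (doubling * g * doubling⁻¹)⁻¹ := by
    rw [conj_pow]
    group
  rw [Matrix.mul_apply, Matrix.mul_apply]
  simp only [outerMatrix_apply, axisMatrix_apply]
  rw [h1, h2, e]

/-- Conjugation by `doubling` on the icosahedral group. -/
def doublingConj (g : Icosahedral) : Icosahedral :=
  evenPerm (doubling * g * doubling⁻¹) (by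
    rw [map_mul, map_mul, map_inv, sign_coe, mul_one, mul_inv_cancel])

theorem outerElement_mul_axisRep (g : Icosahedral) :
    outerElement * axisRep g = axisRep (doublingConj g) * outerElement :=
  Subtype.ext (outerMatrix_mul_axisMatrix g (sign_coe g))

/-- The standard element of order five of the icosahedral group. -/
def baseRotation : Icosahedral := evenPerm baseCycle sign_baseCycle

theorem baseRotation_pow_five : baseRotation ^ 5 = 1 := Subtype.ext (by
  rw [SubgroupClass.coe_pow, baseRotation, coe_evenPerm, baseCycle_pow_five, Subgroup.coe_one])

/-- Since 2 generates the units modulo 5, powers of `outerElement` realise every automorphism of the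
rotation subgroup. -/
theorem outerElement_pow_mul_baseRotation (j : ℕ) :
    outerElement ^ j * axisRep baseRotation =
      axisRep baseRotation ^ 2 ^ j * outerElement ^ j := by
  have h1 : doublingConj baseRotation = baseRotation ^ 2 := Subtype.ext (by
    rw [doublingConj, SubgroupClass.coe_pow, baseRotation, coe_evenPerm, coe_evenPerm]
    decide +kernel)
  have h2 : SemiconjBy outerElement (axisRep baseRotation) (axisRep baseRotation ^ 2) := by
    rw [SemiconjBy, outerElement_mul_axisRep, h1, map_pow]
  induction j with
  | zero => simp
  | succ j ih =>
    have h3 : SemiconjBy outerElement (axisRep baseRotation ^ 2 ^ j)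
        (axisRep baseRotation ^ 2 ^ (j + 1)) := by
      rw [pow_succ' 2 j, pow_mul]
      exact h2.pow_right _
    rw [pow_succ', mul_assoc, ih, ← mul_assoc, h3.eq, mul_assoc]

theorem outerElement_pow_apply_zero (j : ℕ) : (outerElement ^ j).1 0 0 = 1 := by
  have h : outerElement.1 0 0 = 1 := by decide +kernel
  rw [B6.pow_apply_self (by rw [h]; norm_num), h, one_pow]

theorem exists_eq_baseRotation_pow (g : Icosahedral) (hg : (axisRep g).1 0 0 = 1) :
    ∃ k : ℕ, g = baseRotation ^ k := by
  have h := eq_of_axisVec_eq_one (c := g * axisCycle 0 * g⁻¹) hg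
  rw [axisCycle_zero] at h
  obtain ⟨k, hk⟩ := eq_pow_of_conj_baseCycle g.1 (sign_coe g) h
  exact ⟨k, Subtype.ext (by rw [hk, SubgroupClass.coe_pow, baseRotation, coe_evenPerm])⟩

/-- The diagonal matrix with entries `1, -1, -1, -1, -1, -1`. -/
def reflectionMatrix : Matrix (Fin 6) (Fin 6) ℤ := Matrix.diagonal ![1, -1, -1, -1, -1, -1]

/-- `reflectionMatrix` as an element of `B₆`. -/
def reflection : B6 :=
  ⟨reflectionMatrix, (Matrix.mem_orthogonalGroup_iff' _ _).2 (by
    change reflectionMatrix.transpose * reflectionMatrix = 1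
    decide +kernel)⟩

theorem det_reflection : reflection.1.det = -1 := by
  change (Matrix.diagonal ![(1 : ℤ), -1, -1, -1, -1, -1]).det = -1
  rw [Matrix.det_diagonal]
  decide +kernel

theorem B6.inv_apply (A : B6) (i j : Fin 6) : (A⁻¹).1 i j = A.1 j i := rfl

/-- The inversion `x ↦ -x` of `ℤ/5`. -/
def negation : Icosahedral :=
  evenPerm (Equiv.swap 1 4 * Equiv.swap 2 3) (by decide +kernel)

theorem axisRep_negation : (axisRep negation).1 0 0 = -1 := by
  change axisMatrix (Equiv.swap 1 4 * Equiv.swap 2 3) 0 0 = -1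
  decide +kernel

/-- Elements of `B₆` conjugating the standard icosahedral subgroup into itself. -/
def Normalizes (n : B6) : Prop := ∀ g, ∃ g', n * axisRep g = axisRep g' * n

theorem Normalizes.mul {m n : B6} (hm : Normalizes m) (hn : Normalizes n) :
    Normalizes (m * n) := by
  intro g
  obtain ⟨g', h⟩ := hn g
  obtain ⟨g'', h'⟩ := hm g'
  exact ⟨g'', by rw [mul_assoc, h, ← mul_assoc, h', mul_assoc]⟩

theorem normalizes_axisRep (h : Icosahedral) : Normalizes (axisRep h) := fun g =>
  ⟨h * g * h⁻¹, by rw [← map_mul, ← map_mul, inv_mul_cancel_right]⟩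

theorem normalizes_outerElement : Normalizes outerElement := fun g =>
  ⟨_, outerElement_mul_axisRep g⟩

theorem Normalizes.pow {n : B6} (hn : Normalizes n) (j : ℕ) : Normalizes (n ^ j) := by
  induction j with
  | zero => exact fun g => ⟨g, by simp⟩
  | succ j ih =>
    rw [pow_succ]
    exact ih.mul hn

/-- `Normalizes` asks for one inclusion only; in a finite group the inverse is a power, which gives
the other. -/
theorem Normalizes.inv {n : B6} (hn : Normalizes n) : Normalizes n⁻¹ := by
  obtain ⟨k, hk⟩ : ∃ k : ℕ, n⁻¹ = n ^ k := by
    refine ⟨orderOf n - 1, inv_eq_of_mul_eq_one_left ?_⟩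
    rw [← pow_succ, Nat.sub_add_cancel (orderOf_pos n), pow_orderOf_eq_one]
  rw [hk]
  exact hn.pow k

/-- Conjugation by `reflection` changes exactly the signs of the entries in row 0 and column 0 off
the diagonal. Entry `(1, 0)` determines the conjugate of `b` up to a rotation, and entry `(3, 1)`
rules out all five candidates. -/
theorem not_normalizes_reflection : ¬ Normalizes reflection := by
  intro hz
  let b : Icosahedral := evenPerm (axisTransversal 1) (sign_axisTransversal 1)
  obtain ⟨g, hg⟩ := hz b
  have entry (i j : Fin 6) : reflectionMatrix i i * axisMatrix b i j =
      axisMatrix g i j * reflectionMatrix j j := by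
    have h := congrFun (congrFun (congrArg Subtype.val hg) i) j
    rw [Submonoid.coe_mul, Submonoid.coe_mul] at h
    change (reflectionMatrix * axisMatrix b) i j = (axisMatrix g * reflectionMatrix) i j at h
    rw [reflectionMatrix, Matrix.diagonal_mul, Matrix.mul_diagonal] at h
    rw [reflectionMatrix, Matrix.diagonal_apply_eq, Matrix.diagonal_apply_eq]
    exact h
  have hb : axisMatrix b 1 0 = 1 := by
    change axisMatrix (axisTransversal 1) 1 0 = 1
    decide +kernel
  have h10 : (axisRep g).1 1 0 = -1 := by
    have h := entry 1 0
    rw [hb] at h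
    have e0 : reflectionMatrix 0 0 = 1 := rfl
    have e1 : reflectionMatrix 1 1 = -1 := rfl
    rw [e0, e1] at h
    rw [coe_axisRep]
    linarith
  have hd := axisRep_negation
  have hb' : ((axisRep b)⁻¹ : B6).1 0 1 = 1 := hb
  have h1 : (axisRep ((b * negation)⁻¹ * g)).1 0 0 = 1 := by
    rw [map_mul, B6.mul_apply_of_ne_zero _ (by rw [h10]; norm_num), h10, map_inv, B6.inv_apply,
      map_mul, B6.mul_apply_of_ne_zero _ (by rw [hd]; norm_num), hd, coe_axisRep, hb]
    norm_num
  obtain ⟨k, hk⟩ := exists_eq_baseRotation_pow _ h1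
  rw [inv_mul_eq_iff_eq_mul, pow_eq_pow_mod k baseRotation_pow_five] at hk
  -- The entry of `b` is nonzero. Only one `k` gives a nonzero entry on the left, and there it has
  -- the opposite sign.
  have key : ∀ k : Fin 5, axisMatrix (axisTransversal 1 * (Equiv.swap 1 4 * Equiv.swap 2 3) *
      baseCycle ^ (k : ℕ)) 3 1 ≠ axisMatrix (axisTransversal 1) 3 1 := by
    decide +kernel
  have hg' : (g : Equiv.Perm (Fin 5)) = axisTransversal 1 * (Equiv.swap 1 4 * Equiv.swap 2 3) *
      baseCycle ^ (k % 5) := by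
    rw [hk, Subgroup.coe_mul, Subgroup.coe_mul, SubgroupClass.coe_pow]
    rfl
  have h := entry 3 1
  have e1 : reflectionMatrix 1 1 = -1 := rfl
  have e3 : reflectionMatrix 3 3 = -1 := rfl
  rw [e1, e3, hg'] at h
  apply key ⟨k % 5, Nat.mod_lt _ (by norm_num)⟩
  change _ = axisMatrix b 3 1
  linarith

/-- An element of `B₆` commuting with the rotation about an axis and fixing this axis and, up to
sign, another one, is `1` or the reflection. -/
theorem eq_one_or_eq_reflection {n : B6} (h0 : n.1 0 0 = 1) (h1 : n.1 1 1 ≠ 0)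
    (hn : n * axisRep baseRotation = axisRep baseRotation * n) : n = 1 ∨ n = reflection := by
  have step (i j : Fin 6) (hij : axisMatrix baseCycle j i = 1) (hi : n.1 i i ≠ 0) :
      n.1 j j = n.1 i i := by
    have h := congrFun (congrFun (congrArg Subtype.val hn) j) i
    have hij' : (axisRep baseRotation).1 j i = 1 := hij
    have hji : (axisRep baseRotation).1 j i ≠ 0 := by rw [hij']; norm_num
    change (n * axisRep baseRotation).1 j i = (axisRep baseRotation * n).1 j i at h
    rw [B6.mul_apply_of_ne_zero _ hji, B6.mul_apply_of_ne_zero _ hi, hij', mul_one, one_mul] at h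
    exact h
  have e2 := step 1 2 (by decide +kernel) h1
  have e3 := step 2 3 (by decide +kernel) (e2 ▸ h1)
  have e4 := step 3 4 (by decide +kernel) (by rwa [e3, e2])
  have e5 := step 4 5 (by decide +kernel) (by rwa [e4, e3, e2])
  rw [e2] at e3
  rw [e3] at e4
  rw [e4] at e5
  have hdiag : n.1 = Matrix.diagonal fun j => n.1 j j := by
    ext i j
    have hj : n.1 j j ≠ 0 := by
      fin_cases j
      · exact h0 ▸ one_ne_zero
      · exact h1
      · exact e2 ▸ h1
      · exact e3 ▸ h1
      · exact e4 ▸ h1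
      · exact e5 ▸ h1
    rw [B6.apply_of_ne_zero hj, Matrix.diagonal_apply]
    by_cases hij : i = j
    · rw [if_pos hij, if_pos hij, hij]
    · rw [if_neg hij, if_neg hij]
  rcases n.eq_zero_or_eq_one_or_eq_neg_one 1 1 with h | h | h
  · exact absurd h h1
  · left
    refine Subtype.ext ?_
    rw [hdiag, Submonoid.coe_one, ← Matrix.diagonal_one]
    congr 1
    ext j
    fin_cases j
    exacts [h0, h, e2.trans h, e3.trans h, e4.trans h, e5.trans h]
  · right
    refine Subtype.ext ?_
    change n.1 = Matrix.diagonal ![1, -1, -1, -1, -1, -1]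
    rw [hdiag]
    congr 1
    ext j
    fin_cases j
    exacts [h0, h, e2.trans h, e3.trans h, e4.trans h, e5.trans h]

/-- The stabilizer of an axis in the normalizer is generated by the rotation and
`outerElement`. -/
theorem Normalizes.exists_eq_of_apply_zero {n : B6} (hn : Normalizes n) (h0 : n.1 0 0 = 1) :
    ∃ j < 4, ∃ l : ℕ, n = outerElement ^ j * axisRep baseRotation ^ l := by
  set P := axisRep baseRotation with hP
  have hP5 : P ^ 5 = 1 := by rw [hP, ← map_pow, baseRotation_pow_five, map_one]
  have hP00 : P.1 0 0 = 1 := by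
    change axisMatrix baseCycle 0 0 = 1
    decide +kernel
  obtain ⟨g, hg⟩ := hn baseRotation
  have hg0 : (axisRep g).1 0 0 = 1 := by
    have h : (n * P).1 0 0 = (axisRep g * n).1 0 0 := by rw [← hg]
    rw [B6.mul_apply_of_ne_zero _ (by rw [hP00]; norm_num),
      B6.mul_apply_of_ne_zero _ (by rw [h0]; norm_num), hP00, h0, mul_one, mul_one] at h
    exact h.symm
  obtain ⟨k, rfl⟩ := exists_eq_baseRotation_pow g hg0
  rw [map_pow, ← hP] at hg
  -- Nonzero residues modulo 5 are powers of 2; the residue 3 is `2 ^ 3`. The residue 0 would make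
  -- `P` trivial.
  obtain ⟨j, hj, hjk⟩ : ∃ j < 4, P ^ k = P ^ 2 ^ j := by
    have hk : P ^ k = P ^ (k % 5) := pow_eq_pow_mod k hP5
    have hlt : k % 5 < 5 := Nat.mod_lt _ (by norm_num)
    rw [hk] at hg ⊢
    generalize k % 5 = r at *
    interval_cases r
    · exfalso
      rw [pow_zero, one_mul, mul_eq_left, hP] at hg
      have h1 := congrArg Subtype.val (axisRep_injective (hg.trans (map_one axisRep).symm))
      rw [baseRotation, coe_evenPerm, Subgroup.coe_one] at h1
      exact absurd h1 (by decide +kernel)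
    · exact ⟨0, by norm_num, rfl⟩
    · exact ⟨1, by norm_num, rfl⟩
    · refine ⟨3, by norm_num, ?_⟩
      rw [show 2 ^ 3 = 3 + 5 by norm_num, pow_add, hP5, mul_one]
    · exact ⟨2, by norm_num, rfl⟩
  rw [hjk] at hg
  have hf := outerElement_pow_mul_baseRotation j
  rw [← hP] at hf
  have hf0 := outerElement_pow_apply_zero j
  set n₂ := (outerElement ^ j)⁻¹ * n with hn₂
  have h20 : n₂.1 0 0 = 1 := by
    rw [hn₂, B6.mul_apply_of_ne_zero _ (by rw [h0]; norm_num), h0, B6.inv_apply, hf0, mul_one]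
  have hc : Commute n₂ P := by
    rw [Commute, SemiconjBy, hn₂, mul_assoc, hg, inv_mul_eq_iff_eq_mul, ← mul_assoc, ← mul_assoc,
      hf, mul_assoc (P ^ 2 ^ j), mul_inv_cancel, mul_one]
  obtain ⟨m, u, hu⟩ := n₂.exists_col_eq 1
  have hm : n₂.1 m 1 ≠ 0 := by rw [hu, if_pos rfl]; exact u.ne_zero
  have hm0 : m ≠ 0 := by
    rintro rfl
    have h := congrFun (congrFun n₂.transpose_mul_self 0) 1
    have h3 : (n₂⁻¹ * n₂).1 0 1 = 0 := h
    rw [B6.mul_apply_of_ne_zero _ hm, B6.inv_apply, h20, one_mul] at h3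
    exact hm h3
  -- Rotations are transitive on the five axes other than axis 0, so a rotation corrects `n₂` to fix
  -- axis 1 up to sign.
  obtain ⟨l, hl⟩ : ∃ l : ℕ, (P ^ l).1 m 1 = 1 := by
    have key : ∀ m : Fin 6, m ≠ 0 → ∃ l : Fin 5, axisMatrix (baseCycle ^ (l : ℕ)) m 1 = 1 := by
      decide +kernel
    obtain ⟨l, hl⟩ := key m hm0
    refine ⟨l, ?_⟩
    rw [hP, ← map_pow, coe_axisRep, SubgroupClass.coe_pow, baseRotation, coe_evenPerm, hl]
  have hPl0 : (P ^ l).1 0 0 = 1 := by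
    rw [B6.pow_apply_self (by rw [hP00]; norm_num), hP00, one_pow]
  set n₃ := (P ^ l)⁻¹ * n₂ with hn₃
  have h30 : n₃.1 0 0 = 1 := by
    rw [hn₃, B6.mul_apply_of_ne_zero _ (by rw [h20]; norm_num), h20, B6.inv_apply, hPl0, mul_one]
  have h31 : n₃.1 1 1 ≠ 0 := by
    rw [hn₃, B6.mul_apply_of_ne_zero _ hm, B6.inv_apply, hl, one_mul]
    exact hm
  have hc₃ : Commute n₃ P := ((Commute.refl P).pow_left l).inv_left.mul_left hc
  have hn₃N : Normalizes n₃ := by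
    have h1 : Normalizes (P ^ l) := (normalizes_axisRep _).pow l
    exact h1.inv.mul ((normalizes_outerElement.pow j).inv.mul hn)
  rcases eq_one_or_eq_reflection h30 h31 hc₃.eq with h | h
  · refine ⟨j, hj, l, ?_⟩
    rw [hn₃, inv_mul_eq_one, hn₂] at h
    rw [h, mul_inv_cancel_left]
  · exact absurd (h ▸ hn₃N) not_normalizes_reflection

theorem Normalizes.exists_eq {n : B6} (hn : Normalizes n) :
    ∃ (h : Icosahedral) (j : Fin 4), n = axisRep h * outerElement ^ (j : ℕ) := by
  obtain ⟨h, hh⟩ : ∃ h, (axisRep h⁻¹ * n).1 0 0 = 1 := by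
    obtain ⟨m, u, hu⟩ := n.exists_col_eq 0
    have hm : n.1 m 0 = u := by rw [hu, if_pos rfl]
    let t : Icosahedral := evenPerm (axisTransversal m) (sign_axisTransversal m)
    have ht : (axisRep t).1 m 0 = 1 := by
      have h : (axisRep t).1 m 0 =
          axisVec (axisTransversal m * axisCycle 0 * (axisTransversal m)⁻¹) m := rfl
      rw [h, axisCycle_zero, ← axisCycle, axisVec_axisCycle, if_pos rfl]
    have hd := axisRep_negation
    rcases Int.units_eq_one_or u with rfl | rfl
    · refine ⟨t, ?_⟩
      rw [B6.mul_apply_of_ne_zero _ (by rw [hm]; norm_num), hm, map_inv, B6.inv_apply, ht]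
      rfl
    -- `negation` reverses axis 0 and so absorbs the sign `-1`.
    · refine ⟨t * negation, ?_⟩
      rw [B6.mul_apply_of_ne_zero _ (by rw [hm]; norm_num), hm, map_inv, B6.inv_apply, map_mul,
        B6.mul_apply_of_ne_zero _ (by rw [hd]; norm_num), hd, ht]
      rfl
  obtain ⟨j, hj, l, hl⟩ := ((normalizes_axisRep h⁻¹).mul hn).exists_eq_of_apply_zero hh
  obtain ⟨g, hg⟩ := (normalizes_outerElement.pow j) (baseRotation ^ l)
  refine ⟨h * g, ⟨j, hj⟩, ?_⟩
  rw [← map_pow, hg, map_inv, inv_mul_eq_iff_eq_mul] at hl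
  rw [hl, map_mul, mul_assoc]

theorem Normalizes.det_eq_one {n : B6} (hn : Normalizes n) : n.1.det = 1 := by
  obtain ⟨h, j, rfl⟩ := hn.exists_eq
  rw [Submonoid.coe_mul, Matrix.det_mul, det_eq_one_of_hom, SubmonoidClass.coe_pow,
    Matrix.det_pow, det_outerElement, one_pow, one_mul]

/-- For injectivity, two expressions of one element differ by some `axisRep` factor fixing axis 0
with sign `1`, hence by a rotation. Comparing how both conjugate the rotation gives equal `2 ^ i`
and `2 ^ j` modulo 5. -/
theorem card_normalizes : Nat.card {n : B6 // Normalizes n} = 240 := by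
  let F : Icosahedral × Fin 4 → {n : B6 // Normalizes n} := fun x =>
    ⟨axisRep x.1 * outerElement ^ (x.2 : ℕ),
      (normalizes_axisRep _).mul (normalizes_outerElement.pow _)⟩
  have hF : Function.Bijective F := by
    constructor
    · rintro ⟨h, i⟩ ⟨h', j⟩ hij
      have h1 : axisRep h * outerElement ^ (i : ℕ) = axisRep h' * outerElement ^ (j : ℕ) :=
        congrArg Subtype.val hij
      have h2 : axisRep (h'⁻¹ * h) * outerElement ^ (i : ℕ) = outerElement ^ (j : ℕ) := by
        rw [map_mul, map_inv, mul_assoc, h1, inv_mul_cancel_left]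
      have h3 : (axisRep (h'⁻¹ * h)).1 0 0 = 1 := by
        have h4 := outerElement_pow_apply_zero i
        have h5 := outerElement_pow_apply_zero j
        rwa [← h2, B6.mul_apply_of_ne_zero _ (by rw [h4]; norm_num), h4, mul_one] at h5
      obtain ⟨k, hk⟩ := exists_eq_baseRotation_pow _ h3
      have h6 : axisRep baseRotation ^ 2 ^ (i : ℕ) = axisRep baseRotation ^ 2 ^ (j : ℕ) := by
        have h7 := outerElement_pow_mul_baseRotation i
        have h8 := outerElement_pow_mul_baseRotation j
        rw [← h2, mul_assoc, h7, ← mul_assoc, ← mul_assoc, mul_left_inj, hk, map_pow,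
          ← pow_add, ← pow_add, add_comm, pow_add, pow_add, mul_left_inj] at h8
        exact h8
      have key : ∀ i j : Fin 4, baseCycle ^ 2 ^ (i : ℕ) = baseCycle ^ 2 ^ (j : ℕ) → i = j := by
        decide +kernel
      have hij' : i = j := by
        rw [← map_pow, ← map_pow] at h6
        have h9 := congrArg Subtype.val (axisRep_injective h6)
        rw [SubgroupClass.coe_pow, SubgroupClass.coe_pow] at h9
        exact key i j h9
      subst hij'
      rw [mul_left_inj] at h1
      rw [axisRep_injective h1]
    · rintro ⟨n, hn⟩
      obtain ⟨h, j, rfl⟩ := hn.exists_eq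
      exact ⟨(h, j), rfl⟩
  have h60 : Nat.card Icosahedral = 60 := by
    have h := two_mul_nat_card_alternatingGroup (α := Fin 5)
    rw [Nat.card_perm, Nat.card_fin] at h
    change 2 * Nat.card Icosahedral = 120 at h
    omega
  rw [← Nat.card_eq_of_bijective F hF, Nat.card_prod, h60, Nat.card_fin]

theorem mem_normalizer_range_axisRep (n : B6) :
    n ∈ Subgroup.normalizer (axisRep.range : Set B6) ↔ Normalizes n := by
  rw [Subgroup.mem_normalizer_iff]
  constructor
  · intro h g
    obtain ⟨g', hg'⟩ := (h (axisRep g)).1 ⟨g, rfl⟩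
    exact ⟨g', by rw [hg', inv_mul_cancel_right]⟩
  · intro hn x
    constructor
    · rintro ⟨g, rfl⟩
      obtain ⟨g', hg'⟩ := hn g
      exact ⟨g', by rw [hg', mul_inv_cancel_right]⟩
    · rintro ⟨g, hg⟩
      obtain ⟨g', hg'⟩ := hn.inv g
      refine ⟨g', ?_⟩
      rw [hg] at hg'
      rw [← mul_left_inj n⁻¹, ← hg']
      group

/-! ### Conjugacy classes of subgroups -/

/-- The size of a conjugacy class of subgroups is the index of the normalizer. -/
theorem ncard_subgroupConjClass {G : Type*} [Group G] (H : Subgroup G) :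
    (subgroupConjClass H).ncard = (Subgroup.normalizer (H : Set G)).index := by
  have hiff (g g' : G) : H.map (MulAut.conj g).toMonoidHom = H.map (MulAut.conj g').toMonoidHom ↔
      g⁻¹ * g' ∈ Subgroup.normalizer (H : Set G) := by
    have hinj : Function.Injective (MulAut.conj g).toMonoidHom := (MulAut.conj g).injective
    have h : H.map (MulAut.conj g').toMonoidHom =
        (H.map (MulAut.conj (g⁻¹ * g')).toMonoidHom).map (MulAut.conj g).toMonoidHom := by
      rw [Subgroup.map_map]
      congr 1
      ext x
      simp [mul_assoc]
    rw [Subgroup.mem_normalizer_iff_map_conj_eq, h, (Subgroup.map_injective hinj).eq_iff, eq_comm]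
    rfl
  let F : G ⧸ Subgroup.normalizer (H : Set G) → subgroupConjClass H :=
    Quotient.lift (fun g => ⟨H.map (MulAut.conj g).toMonoidHom, g, rfl⟩) fun g g' h =>
      Subtype.ext ((hiff g g').2 (QuotientGroup.leftRel_apply.1 h))
  have hF : Function.Bijective F := by
    constructor
    · intro x y
      induction x using Quotient.inductionOn with | _ g
      induction y using Quotient.inductionOn with | _ g'
      intro h
      exact Quotient.sound (QuotientGroup.leftRel_apply.2 ((hiff g g').1 (congrArg Subtype.val h)))
    · rintro ⟨K, g, rfl⟩
      exact ⟨Quotient.mk _ g, rfl⟩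
  rw [Set.ncard, Set.encard, Subgroup.index, Nat.card_eq_of_bijective F hF]
  rfl

theorem map_conj_mul {G : Type*} [Group G] (H : Subgroup G) (g h : G) :
    H.map (MulAut.conj (g * h)).toMonoidHom =
      (H.map (MulAut.conj h).toMonoidHom).map (MulAut.conj g).toMonoidHom := by
  rw [Subgroup.map_map]
  congr 1
  ext x
  simp [mul_assoc]

theorem map_subtype_map_conj {G : Type*} [Group G] {L N : Subgroup G} (h : L ≤ N) (n : N) :
    ((L.subgroupOf N).map (MulAut.conj n).toMonoidHom).map N.subtype =
      L.map (MulAut.conj (n : G)).toMonoidHom := by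
  conv_rhs => rw [← Subgroup.map_subgroupOf_eq_of_le h]
  rw [Subgroup.map_map, Subgroup.map_map]
  congr 1

/-! ### Crystallographic representations -/

theorem IsCrystallographicRep.map_conj {H : Subgroup B6} (hH : IsCrystallographicRep H) (g : B6) :
    IsCrystallographicRep (H.map (MulAut.conj g).toMonoidHom) := by
  obtain ⟨e, T₁, T₂, h₁, h₂, h, htr⟩ := hH
  refine ⟨e.trans (H.equivMapOfInjective _ (MulAut.conj g).injective), T₁, T₂, h₁, h₂, h,
    fun x => ?_⟩
  rw [← htr]
  have e1 : (((e.trans (H.equivMapOfInjective (MulAut.conj g).toMonoidHom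
      (MulAut.conj g).injective)) x : _) : B6) = g * (e x : B6) * g⁻¹ := rfl
  rw [e1, Submonoid.coe_mul, Matrix.trace_mul_comm, ← Submonoid.coe_mul, ← mul_assoc,
    inv_mul_cancel, one_mul]

/-- The character of a three-dimensional irreducible representation sums to zero. -/
theorem sum_character_eq_zero {T : Representation ℝ Icosahedral (Fin 3 → ℝ)}
    (hT : T.IsIrreducible) : ∑ g, T.character g = 0 := by
  have hcard : (Nat.card Icosahedral : ℝ) ≠ 0 := Nat.cast_ne_zero.2 Nat.card_pos.ne'
  let _ : Invertible (Nat.card Icosahedral : ℝ) := invertibleOfNonzero hcard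
  have hinv : T.invariants = ⊥ := by
    let W : Subrepresentation T := ⟨T.invariants, fun g v hv => by rwa [hv g]⟩
    rcases hT.eq_bot_or_eq_top W with h | h
    · exact congrArg Subrepresentation.toSubmodule h
    · exfalso
      have htriv (g : Icosahedral) (v : Fin 3 → ℝ) : T g v = v := by
        have hv : v ∈ W.toSubmodule := by
          rw [h]
          exact Submodule.mem_top
        exact hv g
      -- If the action were trivial, every line would be a subrepresentation, which is impossible in
      -- dimension 3.
      let L : Subrepresentation T :=
        ⟨Submodule.span ℝ {Pi.single 0 1}, fun g v hv => by rwa [htriv]⟩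
      have hmem (i : Fin 3) : Pi.single i (1 : ℝ) ∈ L.toSubmodule ↔ i = 0 := by
        constructor
        · intro hi
          obtain ⟨a, ha⟩ := Submodule.mem_span_singleton.1 hi
          by_contra hne
          have := congrFun ha i
          simp [hne] at this
        · rintro rfl
          exact Submodule.mem_span_singleton_self _
      rcases hT.eq_bot_or_eq_top L with h1 | h1
      · have h2 := (hmem 0).2 rfl
        rw [h1] at h2
        have h3 := congrFun ((Submodule.mem_bot ℝ).1 h2) 0
        simp at h3
      · have h2 : Pi.single 1 (1 : ℝ) ∈ L.toSubmodule := by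
          rw [h1]
          exact Submodule.mem_top
        exact one_ne_zero ((hmem 1).1 h2)
  have h := Representation.card_inv_mul_sum_char_eq_finrank T
  rw [hinv, finrank_bot, Nat.cast_zero] at h
  exact (mul_eq_zero.1 h).resolve_left (inv_ne_zero hcard)

theorem IsCrystallographicRep.exists_hom {K : Subgroup B6} (hK : IsCrystallographicRep K) :
    ∃ ρ : Icosahedral →* B6, ρ.range = K ∧ ∀ i, ∑ g, (ρ g).1 i i = 0 := by
  obtain ⟨e, T₁, T₂, h₁, h₂, -, htr⟩ := hK
  refine ⟨K.subtype.comp e.toMonoidHom, ?_, fun i => ?_⟩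
  · rw [MonoidHom.range_comp, MonoidHom.range_eq_top.2 e.surjective, ← MonoidHom.range_eq_map,
      Subgroup.range_subtype]
  · have h := sum_eq_zero_of_sum_trace_eq_zero (K.subtype.comp e.toMonoidHom) (by
      have h0 : ∑ g, ((((e g : K) : B6) : Matrix (Fin 6) (Fin 6) ℤ).trace : ℝ) = 0 := by
        rw [Finset.sum_congr rfl fun g _ => htr g, Finset.sum_add_distrib,
          sum_character_eq_zero h₁, sum_character_eq_zero h₂, add_zero]
      exact_mod_cast h0)
    have h1 := congrFun (congrFun h i) i
    rwa [Matrix.sum_apply] at h1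

theorem IsCrystallographicRep.le_B6Plus {K : Subgroup B6} (hK : IsCrystallographicRep K) :
    K ≤ B6Plus := by
  obtain ⟨ρ, rfl, -⟩ := hK.exists_hom
  rintro _ ⟨g, rfl⟩
  exact det_eq_one_of_hom ρ g

/-- The crystallographic representations are the conjugates of the standard subgroup. -/
theorem setOf_isCrystallographicRep :
    {K : Subgroup B6 | IsCrystallographicRep K} = subgroupConjClass axisRep.range := by
  ext K
  constructor
  · intro hK
    obtain ⟨ρ, rfl, h0⟩ := IsCrystallographicRep.exists_hom hK
    obtain ⟨M, hM⟩ := exists_conj_axisRep ρ h0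
    refine ⟨M, ?_⟩
    rw [← MonoidHom.range_comp]
    congr 1
    ext1 g
    change ρ g = M * axisRep g * M⁻¹
    rw [← hM, mul_inv_cancel_right]
  · rintro ⟨g, rfl⟩
    exact isCrystallographicRep_range_axisRep.map_conj g

theorem index_normalizer_range_axisRep :
    (Subgroup.normalizer (axisRep.range : Set B6)).index = 192 := by
  have h := (Subgroup.normalizer (axisRep.range : Set B6)).card_mul_index
  have h1 : Nat.card (Subgroup.normalizer (axisRep.range : Set B6)) = 240 := by
    rw [← card_normalizes]
    exact Nat.card_congr (Equiv.subtypeEquivRight mem_normalizer_range_axisRep)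
  rw [h1, card_B6] at h
  omega

/-! ### Splitting of the class in the determinant-one subgroup -/

theorem mem_B6Plus {A : B6} : A ∈ B6Plus ↔ A.1.det = 1 := Iff.rfl

theorem B6.det_eq_one_or_eq_neg_one (A : B6) : A.1.det = 1 ∨ A.1.det = -1 := by
  have h := congrArg Matrix.det A.transpose_mul_self
  rw [Matrix.det_mul, Matrix.det_transpose, Matrix.det_one] at h
  exact mul_self_eq_one_iff.1 h

theorem mul_reflection_mem_B6Plus_iff (A : B6) : A * reflection ∈ B6Plus ↔ A ∉ B6Plus := by
  rw [mem_B6Plus, mem_B6Plus, Submonoid.coe_mul, Matrix.det_mul, det_reflection]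
  rcases A.det_eq_one_or_eq_neg_one with h | h <;> rw [h] <;> norm_num

theorem index_B6Plus : B6Plus.index = 2 := by
  rw [Subgroup.index_eq_two_iff]
  refine ⟨reflection, fun A => ?_⟩
  rw [mul_reflection_mem_B6Plus_iff]
  exact xor_not_left.2 Iff.rfl

theorem range_axisRep_le_B6Plus : axisRep.range ≤ B6Plus :=
  isCrystallographicRep_range_axisRep.le_B6Plus

/-- This inclusion causes the splitting: the index of the normalizer is halved in `B6Plus`, and no
element of determinant `-1` can bring a conjugate back to itself. -/
theorem normalizer_le_B6Plus : Subgroup.normalizer (axisRep.range : Set B6) ≤ B6Plus :=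
  fun n hn => ((mem_normalizer_range_axisRep n).1 hn).det_eq_one

theorem ncard_subgroupConjClass_subgroupOf :
    (subgroupConjClass (axisRep.range.subgroupOf B6Plus)).ncard = 96 := by
  have h := Subgroup.relIndex_mul_index normalizer_le_B6Plus
  rw [ncard_subgroupConjClass, ← Subgroup.subgroupOf_normalizer_eq range_axisRep_le_B6Plus]
  rw [index_B6Plus, index_normalizer_range_axisRep, Subgroup.relIndex] at h
  omega

/-- The standard subgroup conjugated by an element of determinant `-1`. -/
def reflectedSubgroup : Subgroup B6 := axisRep.range.map (MulAut.conj reflection).toMonoidHom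

theorem reflectedSubgroup_le_B6Plus : reflectedSubgroup ≤ B6Plus :=
  (isCrystallographicRep_range_axisRep.map_conj reflection).le_B6Plus

theorem map_subtype_injective :
    Function.Injective (Subgroup.map (B6Plus.subtype) : Subgroup B6Plus → Subgroup B6) :=
  Subgroup.map_injective B6Plus.subtype_injective

theorem setOf_isCrystallographicRep_B6Plus :
    {K : Subgroup B6Plus | IsCrystallographicRep (K.map B6Plus.subtype)} =
      subgroupConjClass (axisRep.range.subgroupOf B6Plus) ∪
        subgroupConjClass (reflectedSubgroup.subgroupOf B6Plus) := by
  ext K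
  constructor
  · intro hK
    have hK' : K.map B6Plus.subtype ∈ {K : Subgroup B6 | IsCrystallographicRep K} := hK
    rw [setOf_isCrystallographicRep] at hK'
    obtain ⟨g, hg⟩ := hK'
    by_cases hdet : g ∈ B6Plus
    · left
      refine ⟨⟨g, hdet⟩, map_subtype_injective ?_⟩
      rw [hg, map_subtype_map_conj range_axisRep_le_B6Plus]
    · right
      refine ⟨⟨g * reflection⁻¹, ?_⟩, map_subtype_injective ?_⟩
      · by_contra h
        rw [← mul_reflection_mem_B6Plus_iff, inv_mul_cancel_right] at h
        exact hdet h
      · rw [hg, map_subtype_map_conj reflectedSubgroup_le_B6Plus, reflectedSubgroup,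
          ← map_conj_mul, inv_mul_cancel_right]
  · rintro (⟨g, rfl⟩ | ⟨g, rfl⟩)
    · change IsCrystallographicRep _
      rw [map_subtype_map_conj range_axisRep_le_B6Plus]
      exact isCrystallographicRep_range_axisRep.map_conj _
    · change IsCrystallographicRep _
      rw [map_subtype_map_conj reflectedSubgroup_le_B6Plus]
      exact (isCrystallographicRep_range_axisRep.map_conj _).map_conj _

theorem disjoint_subgroupConjClass :
    Disjoint (subgroupConjClass (axisRep.range.subgroupOf B6Plus))
      (subgroupConjClass (reflectedSubgroup.subgroupOf B6Plus)) := by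
  rw [Set.disjoint_left]
  rintro _ ⟨g, rfl⟩ ⟨g', h⟩
  have h1 := congrArg (Subgroup.map B6Plus.subtype) h
  rw [map_subtype_map_conj range_axisRep_le_B6Plus,
    map_subtype_map_conj reflectedSubgroup_le_B6Plus, reflectedSubgroup, ← map_conj_mul] at h1
  -- A common member would put an element of determinant `-1` into the normalizer.
  have h2 : (g : B6)⁻¹ * (g' * reflection) ∈ Subgroup.normalizer (axisRep.range : Set B6) := by
    rw [Subgroup.mem_normalizer_iff_map_conj_eq]
    change axisRep.range.map (MulAut.conj ((g : B6)⁻¹ * (g' * reflection))).toMonoidHom = _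
    rw [map_conj_mul, ← h1, ← map_conj_mul, inv_mul_cancel]
    ext x
    simp
  have h3 := normalizer_le_B6Plus h2
  rw [← mul_assoc, mul_reflection_mem_B6Plus_iff] at h3
  exact h3 (B6Plus.mul_mem (B6Plus.inv_mem g.2) g'.2)

theorem ncard_setOf_isCrystallographicRep :
    {K : Subgroup B6 | IsCrystallographicRep K}.ncard = 192 := by
  rw [setOf_isCrystallographicRep, ncard_subgroupConjClass, index_normalizer_range_axisRep]

theorem ncard_setOf_isCrystallographicRep_B6Plus :
    {K : Subgroup B6Plus | IsCrystallographicRep (K.map B6Plus.subtype)}.ncard = 192 := by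
  rw [← ncard_setOf_isCrystallographicRep, ← Set.ncard_image_of_injective _ map_subtype_injective]
  congr 1
  ext K
  constructor
  · rintro ⟨L, hL, rfl⟩
    exact hL
  · intro hK
    have hle := IsCrystallographicRep.le_B6Plus hK
    refine ⟨K.subgroupOf B6Plus, ?_, Subgroup.map_subgroupOf_eq_of_le hle⟩
    change IsCrystallographicRep _
    rwa [Subgroup.map_subgroupOf_eq_of_le hle]

/-- Obtained by subtraction: of the 192 subgroups, 96 lie in the other, disjoint class. -/
theorem ncard_subgroupConjClass_reflectedSubgroup :
    (subgroupConjClass (reflectedSubgroup.subgroupOf B6Plus)).ncard = 96 := by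
  have h := ncard_setOf_isCrystallographicRep_B6Plus
  rw [setOf_isCrystallographicRep_B6Plus, Set.ncard_union_eq disjoint_subgroupConjClass
    (Set.toFinite _) (Set.toFinite _), ncard_subgroupConjClass_subgroupOf] at h
  omega

theorem proposition1 :
    -- the crystallographic representations are exactly one conjugacy class, of 192 subgroups
    ((∃ H : Subgroup B6, {K : Subgroup B6 | IsCrystallographicRep K} = subgroupConjClass H) ∧
      {K : Subgroup B6 | IsCrystallographicRep K}.ncard = 192) ∧
    -- they all lie in the determinant-one subgroup and form two classes of 96 subgroups there
    ((∀ K : Subgroup B6, IsCrystallographicRep K → K ≤ B6Plus) ∧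
      ∃ H₁ H₂ : Subgroup B6Plus,
        {K : Subgroup B6Plus | IsCrystallographicRep (K.map B6Plus.subtype)} =
          subgroupConjClass H₁ ∪ subgroupConjClass H₂ ∧
        Disjoint (subgroupConjClass H₁) (subgroupConjClass H₂) ∧
        (subgroupConjClass H₁).ncard = 96 ∧
        (subgroupConjClass H₂).ncard = 96) :=
  ⟨⟨⟨_, setOf_isCrystallographicRep⟩, ncard_setOf_isCrystallographicRep⟩,
    fun _ hK => hK.le_B6Plus, _, _, setOf_isCrystallographicRep_B6Plus,
    disjoint_subgroupConjClass, ncard_subgroupConjClass_subgroupOf,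
    ncard_subgroupConjClass_reflectedSubgroup⟩
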